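/- Let $\zeta_7=e^{2\pi i/7}$ and regard $\mathbb{Q}(\zeta_7)\subset\mathbb{Q}(i,\zeta_7)$ as subfields of $\mathbb{C}$. Let $\sigma,\tau$ be the automorphisms of $\mathbb{Q}(i,\zeta_7)$ with $\sigma(i)=-i$, $\sigma(\zeta_7)=\zeta_7$ and $\tau(i)=i$, $\tau(\zeta_7)=\zeta_7^2$. For $c,d\in\mathbb{Q}(i,\zeta_7)$ put $$X(c,d)=\begin{pmatrix} c & -\sqrt{11}\,\sigma(d)\\ \sqrt{11}\,d & \sigma(c)\end{pmatrix},\qquad \alpha_\tau(X)=\operatorname{diag}\bigl(X,\tau(X),\tau^2(X)\bigr)\in M_6(\mathbb{C}),$$ where $\tau$ acts entrywise and fixes $\sqrt{11}$, and let $\mathcal{C}=\{\alpha_\tau(X(c,d)) : c,d\in\mathbb{Z}[i,\zeta_7]\}$. Then: 1. The quaternion algebras $\left(\frac{-11,\,-1}{\mathbb{Q}(\zeta_7)}\right)$ and $\left(\frac{-1,\,-11}{\mathbb{Q}(\zeta_7)}\right)$ are division algebras, and there is an injective $\mathbb{Q}(\zeta_7)$-algebra homomorphism of the latter into $M_2(\mathbb{C})$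 with image $\{X(c,d): c,d\in\mathbb{Q}(i,\zeta_7)\}$. 2. $\mathcal{C}$ has rank $24$: there are $B_1,\dots,B_{24}\in M_6(\mathbb{C})$, linearly independent over $\mathbb{R}$, with $\mathcal{C}=\{\sum_l g_lB_l : g_l\in\mathbb{Z}\}$. 3. $\mathcal{C}$ has the nonvanishing determinant (NVD) property: there is $\kappa>0$ with $\det(Z^\dagger Z)>\kappa$ for all $0\neq Z\in\mathcal{C}$. Moreover $\det Z\in\mathbb{Q}(\sqrt{-7})$ for all $Z\in\mathcal{C}$. 4. $\mathcal{C}$ is conditionally $4$-group decodable with real decoding complexity of order $|S|^{15}$. That is, generators $B_1,\dots,B_{24}$ as in 2 and a partition of $\{1,\dots,24\}$ into nonempty sets $\Gamma_1,\dots,\Gamma_4$ and a set $\Gamma^C$ exist such that $\|B_l^\dagger B_m+B_m^\dagger B_l\|_F=0$ whenever $l\in\Gamma_i$, $m\in\Gamma_j$, $i\ne j$, and $|\Gamma^C|+\max_i|\Gamma_i|=15$. Furthermore, for these generators, there is a constant $K$ such that for every nonempty finite alphabet $S\subset\mathbb{Z}$ there is a search procedure on $S^{24}$, branching only on comparisons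 of values of the metric, which for every $n$, every channel matrix $H\in M_{n\times 6}(\mathbb{C})$ and every received matrix $Y\in M_{n\times 6}(\mathbb{C})$ finds a minimizer $g\in S^{24}$ of $\|Y-H\sum_l g_lB_l\|_F^2$ after computing this metric at no more than $K|S|^{15}$ vectors. -/

import Mathlib

namespace RelayCode

noncomputable section

/-! ### The fields -/

/-- The primitive seventh root of unity `exp(2πi/7)`. -/
def zeta7 : ℂ := Complex.exp (2 * Real.pi * Complex.I / 7)

/-- `K' = ℚ(ζ₇)`, as a subfield of `ℂ`. -/
abbrev FieldK : IntermediateField ℚ ℂ := IntermediateField.adjoin ℚ {zeta7}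

/-- `L' = ℚ(i, ζ₇)`, as a subfield of `ℂ`. -/
abbrev FieldL : IntermediateField ℚ ℂ := IntermediateField.adjoin ℚ {Complex.I, zeta7}

/-- `ℚ(√-7)`, as a subfield of `ℂ`. -/
abbrev FieldQ7 : IntermediateField ℚ ℂ :=
  IntermediateField.adjoin ℚ {(Real.sqrt 7 : ℂ) * Complex.I}

/-- `i` as an element of `L'`. -/
def iL : FieldL := ⟨Complex.I, IntermediateField.subset_adjoin ℚ _ (by simp)⟩

/-- `ζ₇` as an element of `L'`. -/
def zL : FieldL := ⟨zeta7, IntermediateField.subset_adjoin ℚ _ (by simp)⟩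

/-- The ring `ℤ[i, ζ₇]`, inside `L'`. -/
def intRing : Subalgebra ℤ FieldL := Algebra.adjoin ℤ {iL, zL}

theorem zeta7_primitive : IsPrimitiveRoot zeta7 7 := by
  have := Complex.isPrimitiveRoot_exp 7 (by norm_num)
  simpa [zeta7] using this

theorem iL_sq : iL ^ 2 = -1 := by
  apply Subtype.ext
  simp [iL]

theorem zL_pow : zL ^ 7 = 1 := by
  apply Subtype.ext
  simpa [zL] using zeta7_primitive.pow_eq_one

/-- `i³ ζ₇²` is a primitive 28th root of unity. -/
theorem xi_primitive : IsPrimitiveRoot (Complex.I ^ 3 * zeta7 ^ 2) 28 := by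
  have h := Complex.isPrimitiveRoot_exp 28 (by norm_num)
  have hI : Complex.I = Complex.exp (2 * Real.pi * Complex.I / 28) ^ 7 := by
    rw [← Complex.exp_nat_mul]
    refine Complex.exp_pi_div_two_mul_I.symm.trans ?_
    congr 1
    push_cast
    ring
  have hz : zeta7 = Complex.exp (2 * Real.pi * Complex.I / 28) ^ 4 := by
    rw [← Complex.exp_nat_mul, zeta7]
    congr 1
    push_cast
    ring
  have h1 : Complex.I ^ 3 * zeta7 ^ 2
      = Complex.exp (2 * Real.pi * Complex.I / 28) ^ 29 := by
    rw [hz]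
    nth_rewrite 1 [hI]
    ring
  rw [h1]
  exact IsPrimitiveRoot.pow_of_coprime (by simpa using h) 29 (by norm_num)

theorem adjoin_xi :
    IntermediateField.adjoin ℚ {Complex.I ^ 3 * zeta7 ^ 2} = FieldL := by
  set ξ := Complex.I ^ 3 * zeta7 ^ 2 with hξ
  have h7 : zeta7 ^ 7 = 1 := zeta7_primitive.pow_eq_one
  have hI : Complex.I ^ 2 = -1 := Complex.I_sq
  apply le_antisymm
  · rw [IntermediateField.adjoin_le_iff]
    rintro x rfl
    exact mul_mem (pow_mem iL.2 3) (pow_mem zL.2 2)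
  · rw [IntermediateField.adjoin_le_iff]
    have hm : ξ ∈ IntermediateField.adjoin ℚ {ξ} :=
      IntermediateField.subset_adjoin ℚ _ rfl
    rintro x (rfl | rfl)
    · have : Complex.I = ξ ^ 7 := by
        rw [hξ, show (Complex.I ^ 3 * zeta7 ^ 2) ^ 7
          = Complex.I * (Complex.I ^ 2) ^ 10 * (zeta7 ^ 7) ^ 2 by ring, h7, hI]
        ring
      exact this ▸ pow_mem hm 7
    · have : zeta7 = ξ ^ 4 := by
        rw [hξ, show (Complex.I ^ 3 * zeta7 ^ 2) ^ 4
          = zeta7 * (Complex.I ^ 2) ^ 6 * zeta7 ^ 7 by ring, h7, hI]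
        ring
      exact this ▸ pow_mem hm 4

theorem fieldL_cyclotomic : IsCyclotomicExtension {28} ℚ FieldL := by
  rw [← adjoin_xi]
  have hint : IsIntegral ℚ (Complex.I ^ 3 * zeta7 ^ 2) :=
    (xi_primitive.isIntegral (by norm_num)).tower_top
  change IsCyclotomicExtension {28} ℚ
    (IntermediateField.adjoin ℚ {Complex.I ^ 3 * zeta7 ^ 2}).toSubalgebra
  rw [IntermediateField.adjoin_simple_toSubalgebra_of_isAlgebraic hint.isAlgebraic]
  exact xi_primitive.adjoin_isCyclotomicExtension ℚ

/-- For every `a` prime to 28 there is an automorphism of `L'` raising `i` and `ζ₇` to the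
power `a`. -/
theorem exists_aut (a : ℕ) (ha : a.Coprime 28) :
    ∃ f : FieldL ≃ₐ[ℚ] FieldL, f iL = iL ^ a ∧ f zL = zL ^ a := by
  have := fieldL_cyclotomic
  have hz := IsCyclotomicExtension.zeta_spec 28 ℚ FieldL
  have hirr : Irreducible (Polynomial.cyclotomic 28 ℚ) :=
    Polynomial.cyclotomic.irreducible_rat (by norm_num)
  have hf := IsCyclotomicExtension.fromZetaAut_spec (hz.pow_of_coprime a ha) hirr
  refine ⟨IsCyclotomicExtension.fromZetaAut (hz.pow_of_coprime a ha) hirr, ?_, ?_⟩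
  · have h1 : iL ^ 28 = 1 := by
      rw [show iL ^ 28 = (iL ^ 2) ^ 14 by ring, iL_sq]; norm_num
    obtain ⟨k, -, hk⟩ := hz.eq_pow_of_pow_eq_one h1
    rw [← hk, map_pow, hf, ← pow_mul, ← pow_mul, mul_comm]
  · have h1 : zL ^ 28 = 1 := by
      rw [show zL ^ 28 = (zL ^ 7) ^ 4 by ring, zL_pow]; norm_num
    obtain ⟨k, -, hk⟩ := hz.eq_pow_of_pow_eq_one h1
    rw [← hk, map_pow, hf, ← pow_mul, ← pow_mul, mul_comm]

theorem exists_sigma : ∃ f : FieldL ≃ₐ[ℚ] FieldL, f iL = -iL ∧ f zL = zL := by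
  obtain ⟨f, h1, h2⟩ := exists_aut 15 (by norm_num)
  refine ⟨f, ?_, ?_⟩
  · rw [h1, show iL ^ 15 = iL * (iL ^ 2) ^ 7 by ring, iL_sq]; ring
  · rw [h2, show zL ^ 15 = zL * (zL ^ 7) ^ 2 by ring, zL_pow]; ring

theorem exists_tau : ∃ f : FieldL ≃ₐ[ℚ] FieldL, f iL = iL ∧ f zL = zL ^ 2 := by
  obtain ⟨f, h1, h2⟩ := exists_aut 9 (by norm_num)
  refine ⟨f, ?_, ?_⟩
  · rw [h1, show iL ^ 9 = iL * (iL ^ 2) ^ 4 by ring, iL_sq]; ring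
  · rw [h2, show zL ^ 9 = zL ^ 2 * zL ^ 7 by ring, zL_pow]; ring

/-- The automorphism `σ` of `L'` with `i ↦ -i` and `ζ₇ ↦ ζ₇`
(it is determined by these two values). -/
def sigma : FieldL ≃ₐ[ℚ] FieldL := exists_sigma.choose

/-- The automorphism `τ` of `L'` with `i ↦ i` and `ζ₇ ↦ ζ₇²`
(it is determined by these two values). -/
def tau : FieldL ≃ₐ[ℚ] FieldL := exists_tau.choose

theorem sigma_spec : sigma iL = -iL ∧ sigma zL = zL := exists_sigma.choose_spec

theorem tau_spec : tau iL = iL ∧ tau zL = zL ^ 2 := exists_tau.choose_spec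

/-! ### The code -/

/-- The matrix obtained from `X = [[c, -√11 σ(d)], [√11 d, σ(c)]]` by applying an automorphism
`f` of `L'` to its entries, where `f` is extended to `L'(√11)` by `√11 ↦ √11`.
For `f = id` this is `X` itself. -/
def block (f : FieldL ≃ₐ[ℚ] FieldL) (c d : FieldL) : Matrix (Fin 2) (Fin 2) ℂ :=
  !![(f c : ℂ), -(Real.sqrt 11 : ℂ) * (f (sigma d) : ℂ);
     (Real.sqrt 11 : ℂ) * (f d : ℂ), (f (sigma c) : ℂ)]

/-- The matrix `X = [[c, -√11 σ(d)], [√11 d, σ(c)]]`. -/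
def matX (c d : FieldL) : Matrix (Fin 2) (Fin 2) ℂ := block (AlgEquiv.refl) c d

/-- The `6 × 6` matrix `α_τ(X) = diag(X, τ(X), τ²(X))`; an index `(a, k)` stands for
row or column `a` of the `k`-th block. -/
def alphaTau (c d : FieldL) : Matrix (Fin 2 × Fin 3) (Fin 2 × Fin 3) ℂ :=
  Matrix.blockDiagonal fun k : Fin 3 => block (tau ^ (k : ℕ)) c d

/-- The code: all `α_τ(X)` with `c, d ∈ ℤ[i, ζ₇]`. -/
def code : Set (Matrix (Fin 2 × Fin 3) (Fin 2 × Fin 3) ℂ) :=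
  {Z | ∃ c ∈ intRing, ∃ d ∈ intRing, Z = alphaTau c d}

end

/-! ### General notions for space-time codes -/

section General

noncomputable section

variable {m T ι : Type} [Fintype m] [Fintype T] [Fintype ι]

/-- The Frobenius norm. -/
def frob {n : Type} [Fintype n] (A : Matrix n T ℂ) : ℝ :=
  Real.sqrt (∑ i, ∑ j, ‖A i j‖ ^ 2)

/-- Generator matrices of a code `C`: they are independent over `ℝ`, and the codewords are
precisely their integral combinations. -/
def IsGenerating (C : Set (Matrix m T ℂ)) (B : ι → Matrix m T ℂ) : Prop :=
  LinearIndependent ℝ B ∧ C = {X | ∃ g : ι → ℤ, X = ∑ i, g i • B i}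

/-- The code `C` is a lattice of rank `k`. -/
def HasRank (C : Set (Matrix m T ℂ)) (k : ℕ) : Prop :=
  ∃ B : Fin k → Matrix m T ℂ, IsGenerating C B

/-- The nonvanishing determinant property
(the determinant of `X† X` is always a nonnegative real number). -/
def HasNVD [DecidableEq T] (C : Set (Matrix m T ℂ)) : Prop :=
  ∃ κ : ℝ, 0 < κ ∧ ∀ X ∈ C, X ≠ 0 → κ < ((X.conjTranspose * X).det).re

/-- `Γ₁, …, Γ_g, Γ^C` is a partition of the indices, with nonempty `Γ_i`, that makes the code
generated by `B` conditionally `g`-group decodable. -/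
structure IsCondGroupDecodable (B : ι → Matrix m T ℂ) {g : ℕ}
    (Γ : Fin g → Finset ι) (ΓC : Finset ι) : Prop where
  nonempty : ∀ i, (Γ i).Nonempty
  disjoint : ∀ i j, i ≠ j → Disjoint (Γ i) (Γ j)
  disjoint_cond : ∀ i, Disjoint (Γ i) ΓC
  cover : ∀ l, l ∈ ΓC ∨ ∃ i, l ∈ Γ i
  orthogonal : ∀ i j, i ≠ j → ∀ l ∈ Γ i, ∀ k ∈ Γ j,
    frob ((B l).conjTranspose * B k + (B k).conjTranspose * B l) = 0

/-- The exponent `|Γ^C| + max_i |Γ_i|` of `|S|` in the complexity of conditional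
group decoding. -/
def condDegree {g : ℕ} (Γ : Fin g → Finset ι) (ΓC : Finset ι) : ℕ :=
  ΓC.card + Finset.univ.sup fun i => (Γ i).card

/-- A search procedure on a set `V` of candidate vectors: in each step it computes the values of
the metric at two vectors and branches on their comparison; finally it outputs a vector. -/
inductive Search (V : Type) : Type
  | output (v : V) : Search V
  | compare (u v : V) (ifLe ifGt : Search V) : Search V

open Classical in
/-- The output of the procedure for the metric `μ`. -/
def Search.run {V : Type} (μ : V → ℝ) : Search V → V
  | .output v => v
  | .compare u v s t => if μ u ≤ μ v then s.run μ else t.run μ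

open Classical in
/-- The set of vectors at which the procedure computes the metric `μ` when run on `μ`. -/
def Search.evaluated {V : Type} (μ : V → ℝ) : Search V → Finset V
  | .output _ => ∅
  | .compare u v s t => {u, v} ∪ if μ u ≤ μ v then s.evaluated μ else t.evaluated μ

/-- The maximum-likelihood metric `‖Y - H X‖_F²` of the codeword `X = ∑ g_i B_i`. -/
def mlMetric {n : ℕ} (B : ι → Matrix m T ℂ) (S : Finset ℤ) (H : Matrix (Fin n) m ℂ)
    (Y : Matrix (Fin n) T ℂ) (g : ι → S) : ℝ :=
  frob (Y - H * ∑ i, (g i : ℤ) • B i) ^ 2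

/-- Decoding complexity of order `|S|^d`: there is a constant `K` such that for every finite
alphabet `S` there is a search procedure over `S^ι` which, for every number of receive antennas,
every channel matrix `H` and every received matrix `Y`, outputs a maximum-likelihood solution
after computing the metric at no more than `K |S|^d` vectors. -/
def DecodableInOrder (B : ι → Matrix m T ℂ) (d : ℕ) : Prop :=
  ∃ K : ℕ, ∀ S : Finset ℤ, S.Nonempty → ∃ s : Search (ι → S),
    ∀ (n : ℕ) (H : Matrix (Fin n) m ℂ) (Y : Matrix (Fin n) T ℂ),
      (∀ g, mlMetric B S H Y (s.run (mlMetric B S H Y)) ≤ mlMetric B S H Y g) ∧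
      (s.evaluated (mlMetric B S H Y)).card ≤ K * S.card ^ d

/-- A ring in which `0 ≠ 1` and every nonzero element is invertible. -/
def IsDivision (A : Type) [Ring A] : Prop :=
  Nontrivial A ∧ ∀ x : A, x ≠ 0 → IsUnit x

end

end General

end RelayCode

/-! Everything algebraic rests on the form x² + y² + 11(z² + w²) over ℚ(ζ₇), which is, up to the
order of the variables, the norm form of both quaternion algebras. As 11 has order 3 modulo 7, the
residue fields of ℤ[ζ₇] at 11 have 11³ elements, and 11³ ≡ 3 mod 4, so -1 is not a square in them.
Hence 11 ∣ x² + y² forces 11 ∣ x and 11 ∣ y, and infinite descent shows that the form is anisotropic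
(`FieldK_form_eq_zero`). This makes both algebras division algebras, and the matrix representation
injective.

The determinant of a codeword is the product of the three τ-conjugates of a value of this form, so
it vanishes only for the zero codeword. It is fixed by τ, hence three times it is a trace, which
lies in ℤ + ℤη for the Gaussian period η, where 2η + 1 = ±√-7 (`exists_three_mul_det`). So 9|det|²
is a positive integer.

For decoding, codewords are expanded in the units 1, i, j, -k times a ℤ-basis of ℤ[ζ₇] whose first
three members are real in every conjugate; `eq_zero_of_sum_basisConj` gives independence over ℝ.
Distinct units satisfy U†V + V†U = 0 and UV† + VU† = 0, and real scalars preserve both. This gives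
four groups of 3 and leaves 12 indices to condition on: 12 + 3 = 15. The first identity is the one
demanded by the definition of group decodability; the second makes the metric split, because the
channel acts from the left (`separates_mlMetric`). Once the conditioned coordinates are fixed, the
groups can be minimized one after the other (`Search.descend_spec`). -/

namespace RelayCode

/-! ### Search procedures -/

section Decoding

/-- A minimizer among the candidates is found by successive comparisons. -/
def Search.argmin {V : Type} (k : V → Search V) : V → List V → Search V
  | v, [] => k v
  | v, u :: l => .compare u v (Search.argmin k u l) (Search.argmin k v l)

/-- A vector may be compared repeatedly along a branch, but the evaluations made before the
continuation form a subset of the candidates, so each counts once. The continuation `k` is how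
searches are sequenced. -/
theorem Search.argmin_spec {V : Type} (μ : V → ℝ) (k : V → Search V) (l : List V) (v : V) :
    ∃ w ∈ v :: l, (∀ u ∈ v :: l, μ w ≤ μ u) ∧
      (Search.argmin k v l).run μ = (k w).run μ ∧
      ((Search.argmin k v l).evaluated μ).card
        ≤ l.length + 1 + ((k w).evaluated μ).card := by
  classical
  suffices h : ∃ w ∈ v :: l, (∀ u ∈ v :: l, μ w ≤ μ u) ∧
      (Search.argmin k v l).run μ = (k w).run μ ∧
      ((Search.argmin k v l).evaluated μ) ⊆ (v :: l).toFinset ∪ ((k w).evaluated μ) by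
    obtain ⟨w, hw, h1, h2, h3⟩ := h
    refine ⟨w, hw, h1, h2, (Finset.card_le_card h3).trans ((Finset.card_union_le _ _).trans ?_)⟩
    gcongr
    simpa using (v :: l).toFinset_card_le
  induction l generalizing v with
  | nil => exact ⟨v, by simp, by simp, by simp [Search.argmin], by simp [Search.argmin]⟩
  | cons u l ih =>
    by_cases huv : μ u ≤ μ v
    · obtain ⟨w, hw, h1, h2, h3⟩ := ih u
      refine ⟨w, List.mem_cons_of_mem _ hw, ?_, ?_, ?_⟩
      · intro x hx
        rcases List.mem_cons.1 hx with rfl | hx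
        · exact (h1 u (by simp)).trans huv
        · exact h1 x hx
      · simp [Search.argmin, Search.run, huv, h2]
      · simp only [Search.argmin, Search.evaluated, huv, if_true]
        intro x hx
        have := @h3 x
        simp only [Finset.mem_union, Finset.mem_insert, Finset.mem_singleton, List.mem_toFinset,
          List.mem_cons] at hx this ⊢
        tauto
    · obtain ⟨w, hw, h1, h2, h3⟩ := ih v
      refine ⟨w, ?_, ?_, ?_, ?_⟩
      · rcases List.mem_cons.1 hw with rfl | hw
        · simp
        · simp [hw]
      · intro x hx
        rcases List.mem_cons.1 hx with rfl | hx
        · exact h1 _ (by simp)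
        rcases List.mem_cons.1 hx with rfl | hx
        · exact (h1 v (by simp)).trans (not_le.1 huv).le
        · exact h1 x (by simp [hx])
      · simp [Search.argmin, Search.run, huv, h2]
      · simp only [Search.argmin, Search.evaluated, huv, if_false]
        intro x hx
        have := @h3 x
        simp only [Finset.mem_union, Finset.mem_insert, Finset.mem_singleton, List.mem_toFinset,
          List.mem_cons] at hx this ⊢
        tauto

open Classical in
theorem Search.card_evaluated_compare_le {V : Type} (μ : V → ℝ) (u v : V) (s t : Search V) :
    ((Search.compare u v s t).evaluated μ).card
      ≤ 2 + ((if μ u ≤ μ v then s else t).evaluated μ).card := by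
  have h : (Search.compare u v s t).evaluated μ
      = {u, v} ∪ (if μ u ≤ μ v then s else t).evaluated μ := by
    rw [Search.evaluated]
    split_ifs <;> rfl
  rw [h]
  exact (Finset.card_union_le _ _).trans (by gcongr; exact Finset.card_le_two)

variable {ι α : Type} [DecidableEq ι] [Fintype α]

/-- The vector that equals `x` on `G` and `v` elsewhere. -/
def overwrite (G : Finset ι) (v : ι → α) (x : G → α) : ι → α :=
  fun j => if h : j ∈ G then x ⟨j, h⟩ else v j

/-- All vectors that agree with `v` outside `G`. -/
noncomputable def variations (G : Finset ι) (v : ι → α) : List (ι → α) :=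
  (Finset.univ : Finset (G → α)).toList.map (overwrite G v)

theorem length_variations (G : Finset ι) (v : ι → α) :
    (variations G v).length = Fintype.card α ^ G.card := by
  simp [variations]

theorem mem_variations {G : Finset ι} {v w : ι → α} :
    w ∈ variations G v ↔ ∀ j ∉ G, w j = v j := by
  constructor
  · intro h j hj
    obtain ⟨x, -, rfl⟩ := List.mem_map.1 h
    simp [overwrite, hj]
  · intro h
    refine List.mem_map.2 ⟨fun j => w j, by simp, ?_⟩
    funext j
    by_cases hj : j ∈ G
    · simp [overwrite, hj]
    · simp [overwrite, hj, h j hj]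

/-- Minimize over one group of coordinates after the other. -/
noncomputable def Search.descend (k : (ι → α) → Search (ι → α)) :
    List (Finset ι) → (ι → α) → Search (ι → α)
  | [], v => k v
  | G :: Gs, v => Search.argmin (Search.descend k Gs) v (variations G v)

/-- Given the coordinates in `C`, the contributions of the coordinates in `G` to `μ` do not depend
on the remaining coordinates. -/
def Separates (μ : (ι → α) → ℝ) (C G : Finset ι) : Prop :=
  ∀ g g' h h' : ι → α, (∀ j ∈ C, g j = h j) → (∀ j ∉ G, g' j = g j) → (∀ j ∉ G, h' j = h j) →
    (∀ j ∈ G, g j = h j) → (∀ j ∈ G, g' j = h' j) → μ g' - μ g = μ h' - μ h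

/-- `J` collects the coordinates already optimized, and `hv` is the invariant of the induction: `v`
cannot be improved by changes in `J`. Separation lets the invariant pass from `J` to `J ∪ G`. -/
theorem Search.descend_spec (μ : (ι → α) → ℝ) (C : Finset ι) (k : (ι → α) → Search (ι → α))
    (Gs : List (Finset ι)) (hsep : ∀ G ∈ Gs, Separates μ C G) (hC : ∀ G ∈ Gs, Disjoint G C)
    (J : Finset ι) (hJC : Disjoint J C) (v : ι → α)
    (hv : ∀ h : ι → α, (∀ j ∉ J, h j = v j) → μ v ≤ μ h) :
    ∃ w : ι → α, (∀ j ∈ C, w j = v j) ∧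
      (∀ h : ι → α, (∀ j, j ∉ J → (∀ G ∈ Gs, j ∉ G) → h j = v j) → μ w ≤ μ h) ∧
      (Search.descend k Gs v).run μ = (k w).run μ ∧
      ((Search.descend k Gs v).evaluated μ).card
        ≤ (Gs.map fun G => Fintype.card α ^ G.card + 1).sum + ((k w).evaluated μ).card := by
  induction Gs generalizing J v with
  | nil =>
    exact ⟨v, fun _ _ => rfl, fun h hh => hv h fun j hj => hh j hj (by simp), rfl,
      by simp [Search.descend]⟩
  | cons G Gs ih =>
    obtain ⟨w, hw, h1, h2, h3⟩ :=
      Search.argmin_spec μ (Search.descend k Gs) (variations G v) v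
    have hvv : v ∈ variations G v := mem_variations.2 fun _ _ => rfl
    have hwv : ∀ j ∉ G, w j = v j := by
      rcases List.mem_cons.1 hw with rfl | hw
      · exact fun _ _ => rfl
      · exact mem_variations.1 hw
    have hmin : ∀ u : ι → α, (∀ j ∉ G, u j = v j) → μ w ≤ μ u := fun u hu =>
      h1 u (List.mem_cons_of_mem _ (mem_variations.2 hu))
    have hGC : Disjoint G C := hC G (by simp)
    obtain ⟨y, hy, y1, y2, y3⟩ := ih (fun G' h' => hsep G' (by simp [h']))
      (fun G' h' => hC G' (by simp [h'])) (J ∪ G) (Finset.disjoint_union_left.2 ⟨hJC, hGC⟩) w (by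
        intro h hh
        -- Exchange argument: `h0` undoes the change on `G`, and `v'` makes only that change.
        -- Separation equates μ h - μ h0 with μ v' - μ v, while μ v ≤ μ h0 by the invariant and μ w
        -- ≤ μ v' by the choice of `w`.
        let h0 : ι → α := fun j => if j ∈ G then v j else h j
        let v' : ι → α := fun j => if j ∈ G then h j else v j
        have e1 : μ v ≤ μ h0 := hv h0 fun j hj => by
          by_cases hjG : j ∈ G
          · simp [h0, hjG]
          · simp only [h0, hjG, if_false]
            rw [hh j (by simp [hj, hjG]), hwv j hjG]
        have e2 : μ w ≤ μ v' := hmin v' fun j hj => by simp [v', hj]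
        have e3 : μ h - μ h0 = μ v' - μ v := by
          apply hsep G (by simp)
          · intro j hj
            have hjG : j ∉ G := Finset.disjoint_right.1 hGC hj
            have hjJ : j ∉ J := Finset.disjoint_right.1 hJC hj
            simp only [h0, hjG, if_false]
            rw [hh j (by simp [hjJ, hjG]), hwv j hjG]
          · intro j hj; simp [h0, hj]
          · intro j hj; simp [v', hj]
          · intro j hj; simp [h0, hj]
          · intro j hj; simp [v', hj]
        linarith)
    refine ⟨y, ?_, ?_, ?_, ?_⟩
    · intro j hj
      rw [hy j hj, hwv j (Finset.disjoint_right.1 hGC hj)]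
    · intro h hh
      refine y1 h fun j hj hj' => ?_
      simp only [Finset.mem_union, not_or] at hj
      rw [hwv j hj.2]
      exact hh j hj.1 (by simpa using ⟨hj.2, hj'⟩)
    · rw [Search.descend, h2, y2]
    · rw [Search.descend]
      simp only [List.map_cons, List.sum_cons]
      rw [length_variations] at h3
      omega

/-- Descend from each of the given starting points, and keep the best result. -/
noncomputable def Search.sweep (Gs : List (Finset ι)) : List (ι → α) → (ι → α) → Search (ι → α)
  | [], b => .output b
  | v :: vs, b => Search.descend (fun w => .compare w b (Search.sweep Gs vs w)
      (Search.sweep Gs vs b)) Gs v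

/-- Each start yields an optimum among all vectors with the same conditioned coordinates, since the
groups cover the rest; the incumbent `b` never gets worse. The summand 2 pays for the comparison
with the incumbent. -/
theorem Search.sweep_spec (μ : (ι → α) → ℝ) (C : Finset ι) (Gs : List (Finset ι))
    (hsep : ∀ G ∈ Gs, Separates μ C G) (hC : ∀ G ∈ Gs, Disjoint G C)
    (hcov : ∀ j, j ∈ C ∨ ∃ G ∈ Gs, j ∈ G) (vs : List (ι → α)) (b : ι → α) :
    (∀ g : ι → α, μ ((Search.sweep Gs vs b).run μ) ≤ μ b ∧
      ((∃ v ∈ vs, ∀ j ∈ C, g j = v j) → μ ((Search.sweep Gs vs b).run μ) ≤ μ g)) ∧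
    ((Search.sweep Gs vs b).evaluated μ).card
      ≤ vs.length * ((Gs.map fun G => Fintype.card α ^ G.card + 1).sum + 2) := by
  induction vs generalizing b with
  | nil => simp [Search.sweep, Search.run, Search.evaluated]
  | cons v vs ih =>
    obtain ⟨w, hw, h1, h2, h3⟩ := Search.descend_spec μ C
      (fun w => .compare w b (Search.sweep Gs vs w) (Search.sweep Gs vs b)) Gs hsep hC ∅ (by simp)
      v (fun h hh => by rw [funext fun j => hh j (by simp)])
    have hwmin : ∀ g : ι → α, (∀ j ∈ C, g j = v j) → μ w ≤ μ g := fun g hg =>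
      h1 g fun j _ hj => hg j ((hcov j).resolve_right fun ⟨G, hG, hjG⟩ => hj G hG hjG)
    set N := (Gs.map fun G => Fintype.card α ^ G.card + 1).sum
    obtain ⟨x, hx1, hx2, hx3, hx4⟩ : ∃ x, μ x ≤ μ w ∧ μ x ≤ μ b ∧
        (Search.sweep Gs (v :: vs) b).run μ = (Search.sweep Gs vs x).run μ ∧
        ((Search.sweep Gs (v :: vs) b).evaluated μ).card
          ≤ N + 2 + ((Search.sweep Gs vs x).evaluated μ).card := by
      classical
      by_cases hwb : μ w ≤ μ b
      · refine ⟨w, le_rfl, hwb, ?_, ?_⟩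
        · rw [Search.sweep, h2]; simp [Search.run, hwb]
        · rw [Search.sweep]
          refine h3.trans ?_
          rw [add_assoc]
          gcongr
          exact (Search.card_evaluated_compare_le μ w b _ _).trans_eq (by simp [hwb])
      · refine ⟨b, (not_le.1 hwb).le, le_rfl, ?_, ?_⟩
        · rw [Search.sweep, h2]; simp [Search.run, hwb]
        · rw [Search.sweep]
          refine h3.trans ?_
          rw [add_assoc]
          gcongr
          exact (Search.card_evaluated_compare_le μ w b _ _).trans_eq (by simp [hwb])
    obtain ⟨i1, i2⟩ := ih x
    rw [hx3]
    refine ⟨fun g => ⟨(i1 g).1.trans hx2, ?_⟩, ?_⟩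
    · rintro ⟨u, hu, hgu⟩
      rcases List.mem_cons.1 hu with rfl | hu
      · exact (i1 g).1.trans (hx1.trans (hwmin g hgu))
      · exact (i1 g).2 ⟨u, hu, hgu⟩
    · refine hx4.trans ?_
      rw [List.length_cons, Nat.succ_mul]
      omega

/-- Conditional group decoding finds a minimizer of every metric that separates the groups. -/
theorem exists_search [Nonempty α] (C : Finset ι) (Gs : List (Finset ι)) (d : ℕ)
    (hC : ∀ G ∈ Gs, Disjoint G C) (hcov : ∀ j, j ∈ C ∨ ∃ G ∈ Gs, j ∈ G)
    (hd : ∀ G ∈ Gs, C.card + G.card ≤ d) (hCd : C.card ≤ d) :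
    ∃ s : Search (ι → α), ∀ μ : (ι → α) → ℝ, (∀ G ∈ Gs, Separates μ C G) →
      (∀ g, μ (s.run μ) ≤ μ g) ∧
      (s.evaluated μ).card ≤ (2 * Gs.length + 2) * Fintype.card α ^ d := by
  obtain ⟨a⟩ := ‹Nonempty α›
  -- The starts run through all values on `C`; the default `a` elsewhere is immaterial, as the
  -- groups are searched over completely.
  refine ⟨Search.sweep Gs (variations C fun _ => a) fun _ => a, fun μ hsep => ?_⟩
  obtain ⟨h1, h2⟩ := Search.sweep_spec μ C Gs hsep hC hcov (variations C fun _ => a) fun _ => a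
  refine ⟨fun g => (h1 g).2 ⟨fun j => if j ∈ C then g j else a, ?_, ?_⟩, h2.trans ?_⟩
  · exact mem_variations.2 fun j hj => by simp [hj]
  · intro j hj; simp [hj]
  · rw [length_variations]
    have hpos : 0 < Fintype.card α := Fintype.card_pos_iff.2 ⟨a⟩
    clear h1 h2 hsep hcov hC
    -- Both terms of |S|^|C| (|S|^|G| + 1) are at most |S|^d, whence a factor 2 per group; the
    -- incumbent comparisons add the remaining 2.
    have hmul : Fintype.card α ^ C.card * (Gs.map fun G => Fintype.card α ^ G.card + 1).sum
        ≤ 2 * Gs.length * Fintype.card α ^ d := by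
      induction Gs with
      | nil => simp
      | cons G Gs ih =>
        have e1 := ih fun G' h' => hd G' (by simp [h'])
        have e2 : Fintype.card α ^ C.card * Fintype.card α ^ G.card ≤ Fintype.card α ^ d := by
          rw [← pow_add]; exact Nat.pow_le_pow_right hpos (hd G (by simp))
        have e3 := Nat.pow_le_pow_right hpos hCd
        simp only [List.map_cons, List.sum_cons, List.length_cons]
        nlinarith
    have e3 := Nat.pow_le_pow_right hpos hCd
    nlinarith

end Decoding

/-! ### The metric -/

section Metric

variable {m T ι : Type} [Fintype m] [Fintype T] [Fintype ι]

theorem frob_sq {n : Type} [Fintype n] (A : Matrix n T ℂ) :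
    frob A ^ 2 = (A * A.conjTranspose).trace.re := by
  rw [frob, Real.sq_sqrt (by positivity)]
  simp only [Matrix.trace, Matrix.diag, Matrix.mul_apply, Matrix.conjTranspose_apply,
    Complex.re_sum]
  refine Finset.sum_congr rfl fun i _ => Finset.sum_congr rfl fun j _ => ?_
  rw [← Complex.normSq_eq_norm_sq, ← starRingEnd_apply, Complex.mul_conj, Complex.ofReal_re]

theorem frob_sq_sub_sub {n : Type} [Fintype n] (P U V : Matrix n T ℂ)
    (h : U * V.conjTranspose + V * U.conjTranspose = 0) :
    frob (P - U - V) ^ 2 = frob (P - U) ^ 2 + frob (P - V) ^ 2 - frob P ^ 2 := by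
  have e : (P - U - V) * (P - U - V).conjTranspose
      = (P - U) * (P - U).conjTranspose + (P - V) * (P - V).conjTranspose
        - P * P.conjTranspose + (U * V.conjTranspose + V * U.conjTranspose) := by
    simp only [Matrix.conjTranspose_sub, Matrix.sub_mul, Matrix.mul_sub]
    abel
  rw [h, add_zero] at e
  simp only [frob_sq, e, Matrix.trace_sub, Matrix.trace_add, Complex.sub_re, Complex.add_re]

/-- The channel turns UV† + VU† into H(UV† + VU†)H†, so vanishing of the former removes the cross
term between `G` and the remaining coordinates for every `H`. -/
theorem separates_mlMetric [DecidableEq ι] (B : ι → Matrix m T ℂ) (S : Finset ℤ) {n : ℕ}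
    (H : Matrix (Fin n) m ℂ) (Y : Matrix (Fin n) T ℂ) (C G : Finset ι)
    (horth : ∀ l ∈ G, ∀ k, k ∉ G → k ∉ C →
      B l * (B k).conjTranspose + B k * (B l).conjTranspose = 0) :
    Separates (mlMetric B S H Y) C G := by
  intro g g' h h' hC hg hh hgh hgh'
  have hsum : ∀ x : ι → S, ∑ i, (x i : ℤ) • B i = ∑ i ∈ C \ G, (x i : ℤ) • B i
      + ∑ i ∈ G, (x i : ℤ) • B i + ∑ i ∈ (Finset.univ \ G) \ C, (x i : ℤ) • B i := by
    intro x
    rw [← Finset.sum_sdiff (Finset.subset_univ G),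
      ← Finset.sum_inter_add_sum_sdiff (Finset.univ \ G) C]
    rw [show (Finset.univ \ G) ∩ C = C \ G by ext; simp [and_comm]]
    abel
  have key : ∀ x : ι → S, mlMetric B S H Y x
      = frob (Y - H * ∑ i ∈ C \ G, (x i : ℤ) • B i - H * ∑ i ∈ G, (x i : ℤ) • B i) ^ 2
      + frob (Y - H * ∑ i ∈ C \ G, (x i : ℤ) • B i
          - H * ∑ i ∈ (Finset.univ \ G) \ C, (x i : ℤ) • B i) ^ 2
      - frob (Y - H * ∑ i ∈ C \ G, (x i : ℤ) • B i) ^ 2 := by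
    intro x
    rw [← frob_sq_sub_sub, mlMetric, hsum, Matrix.mul_add, Matrix.mul_add]
    · congr 2; abel
    · have : ∀ U V : Matrix m T ℂ, H * U * (H * V).conjTranspose + H * V * (H * U).conjTranspose
          = H * (U * V.conjTranspose + V * U.conjTranspose) * H.conjTranspose := by
        intro U V
        simp only [Matrix.conjTranspose_mul, Matrix.mul_add, Matrix.add_mul, Matrix.mul_assoc]
      rw [this]
      have h0 : (∑ i ∈ G, (x i : ℤ) • B i)
            * (∑ i ∈ (Finset.univ \ G) \ C, (x i : ℤ) • B i).conjTranspose
          + (∑ i ∈ (Finset.univ \ G) \ C, (x i : ℤ) • B i)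
            * (∑ i ∈ G, (x i : ℤ) • B i).conjTranspose = 0 := by
        simp only [Matrix.conjTranspose_sum, Matrix.sum_mul, Matrix.mul_sum]
        rw [Finset.sum_comm (s := (Finset.univ \ G) \ C), ← Finset.sum_add_distrib]
        refine Finset.sum_eq_zero fun l hl => ?_
        rw [← Finset.sum_add_distrib]
        refine Finset.sum_eq_zero fun k hk => ?_
        have hk' : k ∉ G ∧ k ∉ C := by simpa using hk
        have e := horth l hl k hk'.1 hk'.2
        have e2 : ∀ z : ℤ, ∀ M : Matrix m T ℂ, (z • M).conjTranspose = z • M.conjTranspose := by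
          intro z M; ext; simp
        rw [e2, e2, Matrix.smul_mul, Matrix.smul_mul, Matrix.mul_smul, Matrix.mul_smul,
          smul_comm (x k : ℤ) (x l : ℤ), ← smul_add, ← smul_add, e, smul_zero, smul_zero]
      rw [h0]; simp
  have congr_on : ∀ (D : Finset ι) (x y : ι → S), (∀ i ∈ D, x i = y i) →
      ∑ i ∈ D, (x i : ℤ) • B i = ∑ i ∈ D, (y i : ℤ) • B i := fun D x y hxy =>
    Finset.sum_congr rfl fun i hi => by rw [hxy i hi]
  rw [key g, key g', key h, key h',
    congr_on (C \ G) g' g fun i hi => hg i (Finset.mem_sdiff.1 hi).2,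
    congr_on (C \ G) h' h fun i hi => hh i (Finset.mem_sdiff.1 hi).2,
    congr_on (C \ G) g h fun i hi => hC i (Finset.mem_sdiff.1 hi).1,
    congr_on G g h hgh, congr_on G g' h' hgh',
    congr_on ((Finset.univ \ G) \ C) g' g fun i hi => hg i (by simp at hi; exact hi.1),
    congr_on ((Finset.univ \ G) \ C) h' h fun i hi => hh i (by simp at hi; exact hi.1)]
  ring

/-- Generators whose groups are orthogonal for every channel can be decoded group by group. -/
theorem decodableInOrder_of_orthogonal [DecidableEq ι] {B : ι → Matrix m T ℂ} {g : ℕ}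
    {Γ : Fin g → Finset ι} {ΓC : Finset ι} (hΓ : IsCondGroupDecodable B Γ ΓC)
    (horth : ∀ i j, i ≠ j → ∀ l ∈ Γ i, ∀ k ∈ Γ j,
      B l * (B k).conjTranspose + B k * (B l).conjTranspose = 0) :
    DecodableInOrder B (condDegree Γ ΓC) := by
  refine ⟨2 * g + 2, fun S hS => ?_⟩
  have : Nonempty S := hS.to_subtype
  obtain ⟨s, hs⟩ := exists_search (α := S) ΓC (List.ofFn Γ) (condDegree Γ ΓC)
    (by simpa using hΓ.disjoint_cond) (by simpa using hΓ.cover)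
    (by
      simp only [List.mem_ofFn, condDegree]
      rintro _ ⟨i, rfl⟩
      gcongr
      exact Finset.le_sup (f := fun i => (Γ i).card) (Finset.mem_univ i))
    (by simp [condDegree])
  refine ⟨s, fun n H Y => ?_⟩
  have h := hs (mlMetric B S H Y) (by
    simp only [List.mem_ofFn]
    rintro _ ⟨i, rfl⟩
    refine separates_mlMetric B S H Y ΓC (Γ i) fun l hl k hk hkC => ?_
    obtain ⟨j, hj⟩ := (hΓ.cover k).resolve_left hkC
    exact horth i j (by rintro rfl; exact hk hj) l hl k hj)
  simpa using h

end Metric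

open Polynomial

/-! ### The norm form over `ℚ(ζ₇)` -/

/-- The ring `ℤ[ζ₇]`. -/
abbrev ringK : Subalgebra ℤ ℂ := Algebra.adjoin ℤ {zeta7}

theorem zeta7_pow : zeta7 ^ 7 = 1 := zeta7_primitive.pow_eq_one

theorem isIntegral_zeta7 : IsIntegral ℤ zeta7 := zeta7_primitive.isIntegral (by norm_num)

theorem coe_eleven_ringK : ((11 : ringK) : ℂ) = 11 := rfl

theorem coe_eleven_FieldK : ((11 : FieldK) : ℂ) = 11 := rfl

theorem zeta7_mem_ringK : zeta7 ∈ ringK := Algebra.subset_adjoin (Set.mem_singleton zeta7)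

/-- The cube of Frobenius is the identity modulo 11: it is additive and multiplicative there, fixes
integers by Fermat, and fixes ζ₇ because 11³ = 7·190 + 1. -/
theorem eleven_dvd_pow_sub (x : ringK) : (11 : ringK) ∣ x ^ 11 ^ 3 - x := by
  obtain ⟨x, hx⟩ := x
  induction hx using Algebra.adjoin_induction with
  | mem x hx =>
    obtain rfl : x = zeta7 := hx
    refine ⟨0, Subtype.ext ?_⟩
    have h : zeta7 ^ 1331 = (zeta7 ^ 7) ^ 190 * zeta7 := by ring
    rw [zeta7_pow, one_pow, one_mul] at h
    simp [h]
  | algebraMap r =>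
    have h : (11 : ℤ) ∣ r ^ 11 ^ 3 - r := by
      have : Fact (Nat.Prime 11) := ⟨by norm_num⟩
      have h2 : ((r ^ 11 ^ 3 - r : ℤ) : ZMod 11) = 0 := by
        rw [Int.cast_sub, Int.cast_pow, ZMod.pow_card_pow, sub_self]
      exact_mod_cast (ZMod.intCast_zmod_eq_zero_iff_dvd _ 11).1 h2
    obtain ⟨k, hk⟩ := h
    refine ⟨(k : ringK), Subtype.ext ?_⟩
    have := congrArg (Int.cast : ℤ → ℂ) hk
    push_cast at this
    simpa [coe_eleven_ringK] using this
  | add x y hx hy h1 h2 =>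
    obtain ⟨r, hr⟩ := exists_add_pow_prime_pow_eq (p := 11) (by norm_num)
      (⟨x, hx⟩ : ringK) ⟨y, hy⟩ 3
    have e : (⟨x + y, add_mem hx hy⟩ : ringK) ^ 11 ^ 3 - ⟨x + y, add_mem hx hy⟩
        = ((⟨x, hx⟩ : ringK) ^ 11 ^ 3 - ⟨x, hx⟩) + ((⟨y, hy⟩ : ringK) ^ 11 ^ 3 - ⟨y, hy⟩)
          + 11 * (⟨x, hx⟩ * ⟨y, hy⟩ * r) := by
      have h3 : (⟨x + y, add_mem hx hy⟩ : ringK) = ⟨x, hx⟩ + ⟨y, hy⟩ := rfl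
      rw [h3, hr]; push_cast; ring
    rw [e]
    exact dvd_add (dvd_add h1 h2) (dvd_mul_right _ _)
  | mul x y hx hy h1 h2 =>
    have e : (⟨x * y, mul_mem hx hy⟩ : ringK) ^ 11 ^ 3 - ⟨x * y, mul_mem hx hy⟩
        = ((⟨x, hx⟩ : ringK) ^ 11 ^ 3 - ⟨x, hx⟩) * (⟨y, hy⟩ : ringK) ^ 11 ^ 3
          + ⟨x, hx⟩ * ((⟨y, hy⟩ : ringK) ^ 11 ^ 3 - ⟨y, hy⟩) := by
      have h3 : (⟨x * y, mul_mem hx hy⟩ : ringK) = ⟨x, hx⟩ * ⟨y, hy⟩ := rfl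
      rw [h3, mul_pow]; ring
    rw [e]
    exact dvd_add (h1.mul_right _) (h2.mul_left _)

/-- In a ring where `11 = 0` and `r ^ 11³ = r`, the form `x² + y²` is anisotropic. -/
theorem eq_zero_of_sq_add_sq {R : Type*} [CommRing R] (h11 : (11 : R) = 0)
    (hR : ∀ r : R, r ^ 11 ^ 3 = r) {x y : R} (h : x ^ 2 + y ^ 2 = 0) : x = 0 := by
  have hx : x ^ 1330 * x = x := by rw [← pow_succ]; exact hR x
  have hy : y ^ 1330 * y = y := by rw [← pow_succ]; exact hR y
  -- Here 11³ ≡ 3 mod 4 enters: 1330 = 2·665 with 665 odd. The idempotents x^1330 and y^1330 are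
  -- opposite, hence equal, hence killed by 2 as well as by 11.
  have e1 : x ^ 1330 = - y ^ 1330 := by
    rw [show 1330 = 2 * 665 by norm_num, pow_mul, pow_mul, eq_neg_of_add_eq_zero_left h,
      Odd.neg_pow (by decide)]
  have hx2 : x ^ 1330 * x ^ 1330 = x ^ 1330 := by
    calc x ^ 1330 * x ^ 1330 = x ^ 1330 * x * x ^ 1329 := by ring
      _ = x ^ 1330 := by rw [hx]; ring
  have hy2 : y ^ 1330 * y ^ 1330 = y ^ 1330 := by
    calc y ^ 1330 * y ^ 1330 = y ^ 1330 * y * y ^ 1329 := by ring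
      _ = y ^ 1330 := by rw [hy]; ring
  have e2 : x ^ 1330 = y ^ 1330 := by
    rw [← hx2, e1, neg_mul_neg, hy2]
  have e3 : x ^ 1330 = 0 := by
    linear_combination 6 * e1 - 6 * e2 + 12 * e2 - 1 * (x ^ 1330) * h11
  rw [← hx, e3, zero_mul]

theorem eleven_dvd_of_sq_add_sq {x y : ringK} (h : (11 : ringK) ∣ x ^ 2 + y ^ 2) :
    (11 : ringK) ∣ x := by
  have h11 : (11 : ringK ⧸ Ideal.span {(11 : ringK)}) = 0 :=
    Ideal.Quotient.eq_zero_iff_dvd 11 11 |>.2 dvd_rfl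
  rw [← Ideal.Quotient.eq_zero_iff_dvd] at h ⊢
  refine eq_zero_of_sq_add_sq h11 (fun r => ?_)
    (y := Ideal.Quotient.mk (Ideal.span {(11 : ringK)}) y) (by rw [← h]; simp)
  obtain ⟨r, rfl⟩ := Ideal.Quotient.mk_surjective r
  have := eleven_dvd_pow_sub r
  rwa [← Ideal.Quotient.eq_zero_iff_dvd, map_sub, map_pow, sub_eq_zero] at this

/-- Otherwise 1/11 would be a rational number integral over ℤ. -/
theorem not_isUnit_eleven : ¬ IsUnit (11 : ringK) := by
  intro h
  obtain ⟨y, hy⟩ := h.exists_right_inv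
  have hint : IsIntegral ℤ (y : ℂ) :=
    Algebra.adjoin_induction (p := fun x _ => IsIntegral ℤ x)
      (by rintro x rfl; exact isIntegral_zeta7) (fun r => isIntegral_algebraMap)
      (fun x y _ _ => IsIntegral.add) (fun x y _ _ => IsIntegral.mul) y.2
  have hy' : (11 : ℂ) * y = 1 := congrArg Subtype.val hy
  have hyq : (y : ℂ) = algebraMap ℚ ℂ (1 / 11) := by
    simp only [one_div, map_inv₀, map_ofNat]
    exact eq_inv_of_mul_eq_one_right hy'
  rw [hyq, isIntegral_algebraMap_iff (algebraMap ℚ ℂ).injective,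
    IsIntegrallyClosed.isIntegral_iff] at hint
  obtain ⟨n, hn⟩ := hint
  have h2 : (n : ℚ) * 11 = 1 := by
    have : (n : ℚ) = 1 / 11 := by simpa using hn
    rw [this]; norm_num
  have h3 : n * 11 = 1 := by exact_mod_cast h2
  omega

/-- This ends the descent: a nonzero element has finite multiplicity at the nonunit 11. -/
theorem isNoetherianRing_ringK : IsNoetherianRing ringK :=
  isNoetherianRing_of_surjective ℤ[X] ringK
    ((aeval (⟨zeta7, zeta7_mem_ringK⟩ : ringK) : ℤ[X] →ₐ[ℤ] ringK) : ℤ[X] →+* ringK) (by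
      rintro ⟨x, hx⟩
      have hx' : x ∈ Algebra.adjoin ℤ {zeta7} := hx
      rw [Algebra.adjoin_singleton_eq_range_aeval] at hx'
      obtain ⟨p, rfl⟩ := hx'
      refine ⟨p, Subtype.ext ?_⟩
      change (ringK.val (aeval _ p)) = _
      rw [← aeval_algHom_apply]
      rfl)

/-- With x = 11x' and y = 11y', division by 11 gives the same form in z, w, x', y'. Two such steps
divide all four variables by 11. -/
theorem eleven_pow_dvd {x y z w : ringK} (h : x ^ 2 + y ^ 2 + 11 * (z ^ 2 + w ^ 2) = 0) (n : ℕ) :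
    (11 : ringK) ^ n ∣ x := by
  suffices H : (11 : ringK) ^ n ∣ x ∧ (11 : ringK) ^ n ∣ y ∧ (11 : ringK) ^ n ∣ z ∧
      (11 : ringK) ^ n ∣ w from H.1
  have h11 : (11 : ringK) ≠ 0 := fun h0 => by
    have := congrArg Subtype.val h0
    norm_num at this
  have step : ∀ {x y z w : ringK}, x ^ 2 + y ^ 2 + 11 * (z ^ 2 + w ^ 2) = 0 →
      ∃ x' y' : ringK, x = 11 * x' ∧ y = 11 * y' ∧ z ^ 2 + w ^ 2 + 11 * (x' ^ 2 + y' ^ 2) = 0 := by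
    intro x y z w h
    have hd : (11 : ringK) ∣ x ^ 2 + y ^ 2 := ⟨-(z ^ 2 + w ^ 2), by linear_combination h⟩
    obtain ⟨x', rfl⟩ := eleven_dvd_of_sq_add_sq hd
    obtain ⟨y', rfl⟩ := eleven_dvd_of_sq_add_sq (add_comm (_ ^ 2) (y ^ 2) ▸ hd)
    exact ⟨x', y', rfl, rfl, mul_left_cancel₀ h11 (by linear_combination h)⟩
  induction n generalizing x y z w with
  | zero => simp
  | succ n ih =>
    obtain ⟨x', y', rfl, rfl, h'⟩ := step h
    obtain ⟨z', w', rfl, rfl, h''⟩ := step h'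
    obtain ⟨a, b, c, d⟩ := ih h''
    simp only [pow_succ']
    exact ⟨mul_dvd_mul_left _ a, mul_dvd_mul_left _ b, mul_dvd_mul_left _ c, mul_dvd_mul_left _ d⟩

theorem ringK_form_anisotropic {x y z w : ringK}
    (h : x ^ 2 + y ^ 2 + 11 * (z ^ 2 + w ^ 2) = 0) : x = 0 := by
  by_contra hx
  have := isNoetherianRing_ringK
  obtain ⟨n, hn⟩ := FiniteMultiplicity.of_not_isUnit not_isUnit_eleven hx
  exact hn (eleven_pow_dvd h (n + 1))

theorem exists_aeval_of_mem_FieldK {x : ℂ} (hx : x ∈ FieldK) :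
    ∃ p : ℚ[X], x = aeval zeta7 p := by
  have h := IntermediateField.adjoin_simple_toSubalgebra_of_isAlgebraic
    (isIntegral_zeta7.tower_top (A := ℚ)).isAlgebraic
  have hx' : x ∈ FieldK.toSubalgebra := hx
  rw [h, Algebra.adjoin_singleton_eq_range_aeval] at hx'
  obtain ⟨p, rfl⟩ := hx'
  exact ⟨p, rfl⟩

theorem aeval_mem_FieldK (p : ℚ[X]) : aeval zeta7 p ∈ FieldK :=
  IntermediateField.algebra_adjoin_le_adjoin ℚ _ (aeval_mem_adjoin_singleton ℚ zeta7)

theorem exists_mul_mem_ringK {x : ℂ} (hx : x ∈ FieldK) :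
    ∃ n : ℤ, n ≠ 0 ∧ (n : ℂ) * x ∈ ringK := by
  obtain ⟨p, rfl⟩ := exists_aeval_of_mem_FieldK hx
  induction p using Polynomial.induction_on' with
  | add p q hp hq =>
    obtain ⟨n, hn, h1⟩ := hp (aeval_mem_FieldK p)
    obtain ⟨m, hm, h2⟩ := hq (aeval_mem_FieldK q)
    refine ⟨n * m, mul_ne_zero hn hm, ?_⟩
    have e : ((n * m : ℤ) : ℂ) * aeval zeta7 (p + q)
        = m * (n * aeval zeta7 p) + n * (m * aeval zeta7 q) := by
      rw [map_add]; push_cast; ring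
    rw [e]
    exact add_mem (mul_mem (intCast_mem _ _) h1) (mul_mem (intCast_mem _ _) h2)
  | monomial k a =>
    refine ⟨a.den, by exact_mod_cast a.den_ne_zero, ?_⟩
    have e : ((a.den : ℤ) : ℂ) * aeval zeta7 (monomial k a) = (a.num : ℂ) * zeta7 ^ k := by
      rw [aeval_monomial, ← mul_assoc]
      congr 1
      have := Rat.den_mul_eq_num a
      have := congrArg (Rat.cast : ℚ → ℂ) this
      push_cast at this
      simpa using this
    rw [e]
    exact mul_mem (intCast_mem ringK a.num) (pow_mem zeta7_mem_ringK k)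

/-- The norm form of the quaternion algebra `(-1, -11)` is anisotropic over `ℚ(ζ₇)`. -/
theorem FieldK_form_anisotropic {x y z w : ℂ} (hx : x ∈ FieldK) (hy : y ∈ FieldK)
    (hz : z ∈ FieldK) (hw : w ∈ FieldK) (h : x ^ 2 + y ^ 2 + 11 * (z ^ 2 + w ^ 2) = 0) :
    x = 0 := by
  obtain ⟨a, ha, hax⟩ := exists_mul_mem_ringK hx
  obtain ⟨b, hb, hby⟩ := exists_mul_mem_ringK hy
  obtain ⟨c, hc, hcz⟩ := exists_mul_mem_ringK hz
  obtain ⟨d, hd, hdw⟩ := exists_mul_mem_ringK hw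
  have hm : ∀ (k : ℤ) {v : ℂ}, v ∈ ringK → (k : ℂ) * v ∈ ringK := fun k v hv =>
    mul_mem (intCast_mem _ _) hv
  have key := ringK_form_anisotropic (x := ⟨_, hm (b * c * d) hax⟩) (y := ⟨_, hm (a * c * d) hby⟩)
    (z := ⟨_, hm (a * b * d) hcz⟩) (w := ⟨_, hm (a * b * c) hdw⟩) (by
      apply Subtype.ext
      push_cast [coe_eleven_ringK]
      linear_combination ((a : ℂ) * b * c * d) ^ 2 * h)
  have key' : ((b * c * d : ℤ) : ℂ) * (a * x) = 0 := congrArg Subtype.val key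
  simpa [hb, hc, hd, ha] using key'

/-- Multiplying by 11 exchanges the two pairs: (11z)² + (11w)² + 11(x² + y²) = 0. -/
theorem FieldK_form_eq_zero {x y z w : ℂ} (hx : x ∈ FieldK) (hy : y ∈ FieldK)
    (hz : z ∈ FieldK) (hw : w ∈ FieldK) (h : x ^ 2 + y ^ 2 + 11 * (z ^ 2 + w ^ 2) = 0) :
    x = 0 ∧ y = 0 ∧ z = 0 ∧ w = 0 := by
  have hm : ∀ {v : ℂ}, v ∈ FieldK → 11 * v ∈ FieldK := fun hv =>
    mul_mem (ofNat_mem FieldK 11) hv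
  have h11 : (11 : ℂ) ≠ 0 := by norm_num
  refine ⟨FieldK_form_anisotropic hx hy hz hw h,
    FieldK_form_anisotropic hy hx hz hw (by linear_combination h), ?_, ?_⟩
  · simpa using FieldK_form_anisotropic (hm hz) (hm hw) hx hy (by linear_combination 11 * h)
  · simpa using FieldK_form_anisotropic (hm hw) (hm hz) hx hy (by linear_combination 11 * h)

/-! ### The quaternion algebras -/

/-- A quaternion algebra with anisotropic norm form is a division algebra. -/
theorem isDivision_of_anisotropic {F : Type} [Field F] (a b : F)
    (h : ∀ x y z w : F, x ^ 2 - a * y ^ 2 - b * z ^ 2 + a * b * w ^ 2 = 0 →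
      x = 0 ∧ y = 0 ∧ z = 0 ∧ w = 0) :
    IsDivision (QuaternionAlgebra F a 0 b) := by
  refine ⟨⟨0, 1, fun h01 => ?_⟩, fun q hq => ?_⟩
  · simpa using congrArg QuaternionAlgebra.re h01
  · set N := q.re ^ 2 - a * q.imI ^ 2 - b * q.imJ ^ 2 + a * b * q.imK ^ 2 with hN
    have hN0 : N ≠ 0 := fun h0 => hq (by
      obtain ⟨h1, h2, h3, h4⟩ := h _ _ _ _ h0
      ext <;> simp [h1, h2, h3, h4])
    rw [isUnit_iff_exists]
    refine ⟨⟨q.re / N, -q.imI / N, -q.imJ / N, -q.imK / N⟩, ?_, ?_⟩ <;>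
      ext <;> simp <;> field_simp <;> (try rw [hN]) <;> ring

theorem isDivision_neg_eleven_neg_one : IsDivision (QuaternionAlgebra FieldK (-11) 0 (-1)) := by
  refine isDivision_of_anisotropic _ _ fun x y z w h => ?_
  have h' := congrArg (Subtype.val : FieldK → ℂ) h
  push_cast [coe_eleven_FieldK] at h'
  obtain ⟨h1, h2, h3, h4⟩ := FieldK_form_eq_zero x.2 z.2 y.2 w.2 (by linear_combination h')
  exact ⟨Subtype.ext h1, Subtype.ext h3, Subtype.ext h2, Subtype.ext h4⟩

theorem isDivision_neg_one_neg_eleven : IsDivision (QuaternionAlgebra FieldK (-1) 0 (-11)) := by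
  refine isDivision_of_anisotropic _ _ fun x y z w h => ?_
  have h' := congrArg (Subtype.val : FieldK → ℂ) h
  push_cast [coe_eleven_FieldK] at h'
  obtain ⟨h1, h2, h3, h4⟩ := FieldK_form_eq_zero x.2 y.2 z.2 w.2 (by linear_combination h')
  exact ⟨Subtype.ext h1, Subtype.ext h2, Subtype.ext h3, Subtype.ext h4⟩

/-! ### Elements of `ℚ(i, ζ₇)` -/

theorem exists_aeval_add_mul_aeval {R A : Type*} [CommRing R] [CommRing A] [Algebra R A] {i z : A}
    (hi : i ^ 2 = -1) {x : A} (hx : x ∈ Algebra.adjoin R {i, z}) :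
    ∃ p q : R[X], x = aeval z p + i * aeval z q := by
  induction hx using Algebra.adjoin_induction with
  | mem x hx =>
    rcases hx with rfl | rfl
    · exact ⟨0, 1, by simp⟩
    · exact ⟨X, 0, by simp⟩
  | algebraMap r => exact ⟨C r, 0, by simp⟩
  | add x y _ _ hx hy =>
    obtain ⟨p, q, rfl⟩ := hx
    obtain ⟨p', q', rfl⟩ := hy
    exact ⟨p + p', q + q', by simp only [map_add]; ring⟩
  | mul x y _ _ hx hy =>
    obtain ⟨p, q, rfl⟩ := hx
    obtain ⟨p', q', rfl⟩ := hy
    refine ⟨p * p' - q * q', p * q' + q * p', ?_⟩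
    simp only [map_add, map_sub, map_mul]
    linear_combination aeval z q * aeval z q' * hi

theorem coe_iL : (iL : ℂ) = Complex.I := rfl

theorem coe_zL : (zL : ℂ) = zeta7 := rfl

theorem coe_aeval_rat (x : FieldL) (p : ℚ[X]) : ((aeval x p : FieldL) : ℂ) = aeval (x : ℂ) p :=
  (aeval_algHom_apply FieldL.val x p).symm

theorem coe_aeval_int (x : FieldL) (p : ℤ[X]) : ((aeval x p : FieldL) : ℂ) = aeval (x : ℂ) p :=
  (aeval_algHom_apply (FieldL.val.restrictScalars ℤ) x p).symm

theorem aut_aeval_rat (f : FieldL ≃ₐ[ℚ] FieldL) (x : FieldL) (p : ℚ[X]) :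
    f (aeval x p) = aeval (f x) p :=
  (aeval_algHom_apply f.toAlgHom x p).symm

theorem aut_aeval_int (f : FieldL ≃ₐ[ℚ] FieldL) (x : FieldL) (p : ℤ[X]) :
    f (aeval x p) = aeval (f x) p :=
  (aeval_algHom_apply (f.toAlgHom.restrictScalars ℤ) x p).symm

/-- In these coordinates the Galois action is explicit: σ negates the `i`-part, and τ replaces ζ₇ by
ζ₇². -/
theorem exists_aeval_FieldL (c : FieldL) : ∃ p q : ℚ[X], c = aeval zL p + iL * aeval zL q := by
  have hz : IsIntegral ℤ zeta7 := isIntegral_zeta7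
  have hI : IsIntegral ℤ Complex.I :=
    IsIntegral.of_pow (n := 2) (by norm_num) (by rw [Complex.I_sq]; exact isIntegral_one.neg)
  have h : FieldL.toSubalgebra = Algebra.adjoin ℚ {Complex.I, zeta7} :=
    IntermediateField.adjoin_toSubalgebra_of_isAlgebraic (by
      rintro x (rfl | rfl)
      · exact (hI.tower_top (A := ℚ)).isAlgebraic
      · exact (hz.tower_top (A := ℚ)).isAlgebraic)
  have hc : (c : ℂ) ∈ FieldL.toSubalgebra := c.2
  rw [h] at hc
  obtain ⟨p, q, hpq⟩ := exists_aeval_add_mul_aeval Complex.I_sq hc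
  refine ⟨p, q, Subtype.ext ?_⟩
  push_cast
  rw [hpq, coe_aeval_rat, coe_aeval_rat, coe_iL, coe_zL]

theorem exists_aeval_intRing {c : FieldL} (hc : c ∈ intRing) :
    ∃ p q : ℤ[X], c = aeval zL p + iL * aeval zL q :=
  exists_aeval_add_mul_aeval iL_sq hc

theorem aeval_mem_intRing (p : ℤ[X]) : aeval zL p ∈ intRing :=
  Algebra.adjoin_mono (by simp) (aeval_mem_adjoin_singleton ℤ zL)

theorem iL_mem_intRing : iL ∈ intRing := Algebra.subset_adjoin (by simp)

theorem sigma_aeval_rat (p : ℚ[X]) : sigma (aeval zL p) = aeval zL p := by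
  rw [aut_aeval_rat, sigma_spec.2]

theorem sigma_aeval_int (p : ℤ[X]) : sigma (aeval zL p) = aeval zL p := by
  rw [aut_aeval_int, sigma_spec.2]

theorem tau_pow_iL (k : ℕ) : (tau ^ k) iL = iL := by
  induction k with
  | zero => rfl
  | succ k ih => rw [pow_succ, AlgEquiv.mul_apply, tau_spec.1, ih]

theorem tau_pow_zL (k : ℕ) : (tau ^ k) zL = zL ^ 2 ^ k := by
  induction k with
  | zero => simp
  | succ k ih => rw [pow_succ, AlgEquiv.mul_apply, tau_spec.2, map_pow, ih, ← pow_mul, pow_succ]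

theorem coe_tau_pow_aeval (k : ℕ) (p : ℤ[X]) :
    (((tau ^ k) (aeval zL p) : FieldL) : ℂ) = aeval (zeta7 ^ 2 ^ k) p := by
  rw [aut_aeval_int, tau_pow_zL, coe_aeval_int]
  simp [coe_zL]

/-! ### The matrix representation -/

theorem sqrt_eleven_mul_self : (Real.sqrt 11 : ℂ) * (Real.sqrt 11 : ℂ) = 11 := by
  rw [← Complex.ofReal_mul, Real.mul_self_sqrt (by norm_num)]
  norm_num

/-- The images of `1, i, j` and `-k`. -/
noncomputable def unitMat : Fin 4 → Matrix (Fin 2) (Fin 2) ℂ :=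
  ![1, !![Complex.I, 0; 0, -Complex.I], !![0, -(Real.sqrt 11 : ℂ); (Real.sqrt 11 : ℂ), 0],
    !![0, (Real.sqrt 11 : ℂ) * Complex.I; (Real.sqrt 11 : ℂ) * Complex.I, 0]]

/-- The images of the generators of the quaternion algebra. -/
noncomputable def quatBasis :
    QuaternionAlgebra.Basis (Matrix (Fin 2) (Fin 2) ℂ) (-1 : FieldK) 0 (-11) where
  i := unitMat 1
  j := unitMat 2
  k := -unitMat 3
  i_mul_i := by
    ext a b
    fin_cases a <;> fin_cases b <;> simp [unitMat, Matrix.mul_apply, Fin.sum_univ_two]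
  j_mul_j := by
    ext a b
    fin_cases a <;> fin_cases b <;>
      simp [unitMat, Matrix.mul_apply, Fin.sum_univ_two, sqrt_eleven_mul_self, Algebra.smul_def,
        coe_eleven_FieldK]
  i_mul_j := by
    ext a b
    fin_cases a <;> fin_cases b <;>
      simp [unitMat, Matrix.mul_apply, Fin.sum_univ_two, mul_comm]
  j_mul_i := by
    ext a b
    fin_cases a <;> fin_cases b <;>
      simp [unitMat, Matrix.mul_apply, Fin.sum_univ_two, mul_comm]

theorem quatBasis_lift (q : QuaternionAlgebra FieldK (-1) 0 (-11)) :
    quatBasis.lift q = (q.re : ℂ) • unitMat 0 + (q.imI : ℂ) • unitMat 1 + (q.imJ : ℂ) • unitMat 2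
      + (-q.imK : ℂ) • unitMat 3 := by
  have h : ∀ (r : FieldK) (M : Matrix (Fin 2) (Fin 2) ℂ), r • M = (r : ℂ) • M := fun _ _ => rfl
  rw [QuaternionAlgebra.Basis.lift, Algebra.algebraMap_eq_smul_one, h, h, h, h]
  simp [quatBasis, unitMat]

theorem matX_aeval (p q r s : ℚ[X]) :
    matX (aeval zL p + iL * aeval zL q) (aeval zL r + iL * aeval zL s)
      = aeval zeta7 p • unitMat 0 + aeval zeta7 q • unitMat 1 + aeval zeta7 r • unitMat 2
        + aeval zeta7 s • unitMat 3 := by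
  ext a b
  fin_cases a <;> fin_cases b <;>
    simp [matX, block, unitMat, sigma_aeval_rat, sigma_spec.1, coe_aeval_rat, coe_iL, coe_zL] <;>
    ring

theorem exists_quaternion_embedding :
    ∃ ρ : QuaternionAlgebra FieldK (-1) 0 (-11) →ₐ[FieldK] Matrix (Fin 2) (Fin 2) ℂ,
      Function.Injective ρ ∧ Set.range ρ = {X | ∃ c d : FieldL, X = matX c d} := by
  refine ⟨quatBasis.liftHom, ?_, ?_⟩
  · rw [injective_iff_map_eq_zero]
    intro x hx
    by_contra h0
    have := (isDivision_neg_one_neg_eleven.2 x h0).map quatBasis.liftHom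
    rw [hx] at this
    exact not_isUnit_zero this
  · ext M
    simp only [Set.mem_range, Set.mem_ofPred_eq]
    constructor
    · rintro ⟨q, rfl⟩
      obtain ⟨p0, h0⟩ := exists_aeval_of_mem_FieldK q.re.2
      obtain ⟨p1, h1⟩ := exists_aeval_of_mem_FieldK q.imI.2
      obtain ⟨p2, h2⟩ := exists_aeval_of_mem_FieldK q.imJ.2
      obtain ⟨p3, h3⟩ := exists_aeval_of_mem_FieldK q.imK.2
      -- The sign on `p3` appears because X(0, i) is the image of -k.
      refine ⟨aeval zL p0 + iL * aeval zL p1, aeval zL p2 + iL * aeval zL (-p3), ?_⟩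
      rw [matX_aeval, map_neg, ← h0, ← h1, ← h2, ← h3]
      exact quatBasis_lift q
    · rintro ⟨c, d, rfl⟩
      obtain ⟨p, q, rfl⟩ := exists_aeval_FieldL c
      obtain ⟨r, s, rfl⟩ := exists_aeval_FieldL d
      refine ⟨⟨⟨_, aeval_mem_FieldK p⟩, ⟨_, aeval_mem_FieldK q⟩, ⟨_, aeval_mem_FieldK r⟩,
        ⟨_, aeval_mem_FieldK (-s)⟩⟩, ?_⟩
      rw [matX_aeval]
      exact (quatBasis_lift _).trans (by simp)

/-! ### Determinants -/

/-- The reduced norm of `X(c, d)`. -/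
noncomputable def redNorm (c d : FieldL) : FieldL := c * sigma c + 11 * (d * sigma d)

theorem det_block (f : FieldL ≃ₐ[ℚ] FieldL) (c d : FieldL) :
    (block f c d).det = (f (redNorm c d) : ℂ) := by
  have h11 : ((11 : FieldL) : ℂ) = 11 := rfl
  rw [Matrix.det_fin_two]
  simp only [block, redNorm, map_add, map_mul, map_ofNat, Matrix.of_apply,
    Matrix.cons_val', Matrix.cons_val_zero, Matrix.cons_val_one, Matrix.cons_val_fin_one]
  push_cast [h11]
  linear_combination (f d : ℂ) * f (sigma d) * sqrt_eleven_mul_self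

theorem det_alphaTau (c d : FieldL) :
    (alphaTau c d).det = ∏ k : Fin 3, (((tau ^ (k : ℕ)) (redNorm c d) : FieldL) : ℂ) := by
  rw [alphaTau, Matrix.det_blockDiagonal]
  simp_rw [det_block]

/-- As σ negates i and fixes ζ₇, c σ(c) = p² + q²: the reduced norm is a value of the anisotropic
form. -/
theorem redNorm_aeval (p q r s : ℤ[X]) :
    redNorm (aeval zL p + iL * aeval zL q) (aeval zL r + iL * aeval zL s)
      = aeval zL (p ^ 2 + q ^ 2 + 11 * (r ^ 2 + s ^ 2)) := by
  simp only [redNorm, map_add, map_mul, sigma_aeval_int, sigma_spec.1, map_pow, map_ofNat]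
  linear_combination (-(aeval zL q) ^ 2 - 11 * (aeval zL s) ^ 2) * iL_sq

theorem eq_zero_of_redNorm {c d : FieldL} (hc : c ∈ intRing) (hd : d ∈ intRing)
    (h : redNorm c d = 0) : c = 0 ∧ d = 0 := by
  obtain ⟨p, q, rfl⟩ := exists_aeval_intRing hc
  obtain ⟨r, s, rfl⟩ := exists_aeval_intRing hd
  rw [redNorm_aeval] at h
  have hK : ∀ P : ℤ[X], aeval zeta7 P ∈ FieldK := fun P => by
    rw [← aeval_map_algebraMap ℚ]
    exact aeval_mem_FieldK _
  have h' := congrArg (Subtype.val : FieldL → ℂ) h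
  rw [coe_aeval_int, coe_zL] at h'
  simp only [map_add, map_mul, map_pow, map_ofNat] at h'
  obtain ⟨h1, h2, h3, h4⟩ := FieldK_form_eq_zero (hK p) (hK q) (hK r) (hK s) h'
  have hL : ∀ P : ℤ[X], aeval zeta7 P = 0 → aeval zL P = 0 := fun P hP =>
    Subtype.ext (by rw [coe_aeval_int, coe_zL, hP]; rfl)
  simp [hL p h1, hL q h2, hL r h3, hL s h4]

/-- The Gaussian period `ζ₇ + ζ₇² + ζ₇⁴`. -/
noncomputable def period : ℂ := zeta7 + zeta7 ^ 2 + zeta7 ^ 4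

theorem zeta7_sum : 1 + zeta7 + zeta7 ^ 2 + zeta7 ^ 3 + zeta7 ^ 4 + zeta7 ^ 5 + zeta7 ^ 6 = 0 := by
  have h := zeta7_primitive.geom_sum_eq_zero (by norm_num)
  simpa [Finset.sum_range_succ] using h

/-- The period is a root of t² + t + 2; the sign of the root plays no role later. -/
theorem period_eq : (2 * period + 1 = Real.sqrt 7 * Complex.I) ∨
    (2 * period + 1 = -(Real.sqrt 7 * Complex.I)) := by
  rw [← sq_eq_sq_iff_eq_or_eq_neg]
  have h7 : (Real.sqrt 7 : ℂ) ^ 2 = 7 := by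
    rw [← Complex.ofReal_pow, Real.sq_sqrt (by norm_num)]
    norm_num
  rw [mul_pow, Complex.I_sq, h7, period]
  linear_combination 8 * zeta7_sum + 4 * zeta7 * zeta7_pow

/-- The exponents n, 2n, 4n form an orbit of doubling modulo 7: {0} gives 3, {1, 2, 4} gives η, and
{3, 5, 6} gives -1 - η. -/
theorem exists_trace_eq (Q : ℤ[X]) : ∃ u v : ℤ,
    aeval zeta7 Q + aeval (zeta7 ^ 2) Q + aeval (zeta7 ^ 4) Q = u + v * period := by
  induction Q using Polynomial.induction_on' with
  | add p q hp hq =>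
    obtain ⟨u, v, h⟩ := hp
    obtain ⟨u', v', h'⟩ := hq
    refine ⟨u + u', v + v', ?_⟩
    simp only [map_add]
    push_cast
    linear_combination h + h'
  | monomial n a =>
    suffices H : ∃ u v : ℤ, zeta7 ^ n + (zeta7 ^ 2) ^ n + (zeta7 ^ 4) ^ n = u + v * period by
      obtain ⟨u, v, h⟩ := H
      refine ⟨a * u, a * v, ?_⟩
      simp only [aeval_monomial, eq_intCast]
      push_cast
      linear_combination a * h
    have hmod : ∀ m : ℕ, zeta7 ^ m = zeta7 ^ (m % 7) := fun m => pow_eq_pow_mod m zeta7_pow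
    have hn : n % 7 < 7 := Nat.mod_lt _ (by norm_num)
    rw [← pow_mul, ← pow_mul, mul_comm 2, mul_comm 4, pow_mul, pow_mul, hmod n]
    generalize n % 7 = r at hn
    interval_cases r
    · exact ⟨3, 0, by norm_num⟩
    · exact ⟨0, 1, by rw [period]; push_cast; ring⟩
    · exact ⟨0, 1, by rw [period]; push_cast; linear_combination zeta7 * zeta7_pow⟩
    · exact ⟨-1, -1, by
        rw [period]; push_cast
        linear_combination zeta7_sum + zeta7 ^ 5 * zeta7_pow⟩
    · exact ⟨0, 1, by
        rw [period]; push_cast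
        linear_combination (zeta7 + zeta7 ^ 9 + zeta7 ^ 2) * zeta7_pow⟩
    · exact ⟨-1, -1, by
        rw [period]; push_cast
        linear_combination zeta7_sum + (zeta7 ^ 3 + zeta7 ^ 13 + zeta7 ^ 6) * zeta7_pow⟩
    · exact ⟨-1, -1, by
        rw [period]; push_cast
        linear_combination
          zeta7_sum + (zeta7 ^ 5 + zeta7 ^ 17 + zeta7 ^ 10 + zeta7 ^ 3) * zeta7_pow⟩

/-- τ permutes the three factors of the determinant cyclically, so its trace is three times itself.
The factor 3 avoids determining the fixed ring of τ. -/
theorem exists_three_mul_det {Z : Matrix (Fin 2 × Fin 3) (Fin 2 × Fin 3) ℂ} (hZ : Z ∈ code) :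
    ∃ u v : ℤ, 3 * Z.det = u + v * period := by
  obtain ⟨c, hc, d, hd, rfl⟩ := hZ
  obtain ⟨p, q, rfl⟩ := exists_aeval_intRing hc
  obtain ⟨r, s, rfl⟩ := exists_aeval_intRing hd
  rw [det_alphaTau, redNorm_aeval]
  generalize p ^ 2 + q ^ 2 + 11 * (r ^ 2 + s ^ 2) = P
  -- This product takes the same value, the determinant, at ζ₇, ζ₇² and ζ₇⁴.
  obtain ⟨u, v, h⟩ := exists_trace_eq (P * P.comp (X ^ 2) * P.comp (X ^ 4))
  refine ⟨u, v, h ▸ ?_⟩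
  simp only [coe_tau_pow_aeval, Fin.prod_univ_three, map_mul, aeval_comp, map_pow, aeval_X]
  have e1 : (zeta7 ^ 2) ^ 4 = zeta7 := by linear_combination zeta7 * zeta7_pow
  have e2 : (zeta7 ^ 4) ^ 2 = zeta7 := by linear_combination zeta7 * zeta7_pow
  have e3 : (zeta7 ^ 4) ^ 4 = zeta7 ^ 2 := by
    linear_combination (zeta7 ^ 9 + zeta7 ^ 2) * zeta7_pow
  have e4 : (zeta7 ^ 2) ^ 2 = zeta7 ^ 4 := by ring
  rw [e1, e2, e3, e4]
  norm_num
  ring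

theorem det_mem_FieldQ7 {Z : Matrix (Fin 2 × Fin 3) (Fin 2 × Fin 3) ℂ} (hZ : Z ∈ code) :
    Z.det ∈ FieldQ7 := by
  obtain ⟨u, v, h⟩ := exists_three_mul_det hZ
  have hs : (Real.sqrt 7 : ℂ) * Complex.I ∈ FieldQ7 :=
    IntermediateField.mem_adjoin_simple_self ℚ _
  have hp : 2 * period + 1 ∈ FieldQ7 := by
    rcases period_eq with h | h <;> rw [h]
    · exact hs
    · exact neg_mem hs
  have e : Z.det = (u + v * ((2 * period + 1 - 1) / 2)) / 3 := by linear_combination h / 3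
  rw [e]
  have h2 : (2 : ℂ) ∈ FieldQ7 := ofNat_mem FieldQ7 2
  have h3 : (3 : ℂ) ∈ FieldQ7 := ofNat_mem FieldQ7 3
  exact div_mem (add_mem (intCast_mem FieldQ7 u) (mul_mem (intCast_mem FieldQ7 v)
    (div_mem (sub_mem hp (one_mem FieldQ7)) h2))) h3

/-- The norm form of ℤ[η], from Re η = -1/2 and |η|² = 2. -/
theorem normSq_add_mul_period (u v : ℤ) :
    Complex.normSq (u + v * period) = ((u ^ 2 - u * v + 2 * v ^ 2 : ℤ) : ℝ) := by
  have h7 : Real.sqrt 7 * Real.sqrt 7 = 7 := Real.mul_self_sqrt (by norm_num)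
  have hre : 2 * period.re + 1 = 0 := by
    rcases period_eq with h | h <;> simpa using congrArg Complex.re h
  have him : 4 * period.im ^ 2 = 7 := by
    rcases period_eq with h | h <;>
    · have h' := congrArg Complex.im h
      simp at h'
      rw [← h7, ← mul_self_eq_mul_self_iff.2 (by first | exact Or.inl h' | exact Or.inr h')]
      ring
  have hre' : period.re = -1 / 2 := by linarith
  rw [Complex.normSq_apply]
  simp only [Complex.add_re, Complex.add_im, Complex.mul_re, Complex.mul_im, Complex.intCast_re,
    Complex.intCast_im, hre']
  push_cast
  linear_combination (v : ℝ) ^ 2 / 4 * him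

theorem code_hasNVD : HasNVD code := by
  -- Since |det|² ≥ 1/9, any constant below 1/9 serves.
  refine ⟨1 / 10, by norm_num, fun Z hZ hZ0 => ?_⟩
  have hdet : Z.det ≠ 0 := by
    obtain ⟨c, hc, d, hd, rfl⟩ := hZ
    rw [det_alphaTau, Finset.prod_ne_zero_iff]
    intro k _ h0
    have h1 : (tau ^ (k : ℕ)) (redNorm c d) = 0 := Subtype.ext h0
    obtain ⟨rfl, rfl⟩ := eq_zero_of_redNorm hc hd ((map_eq_zero_iff _ (AlgEquiv.injective _)).1 h1)
    apply hZ0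
    ext i j
    simp only [alphaTau, block, map_zero, ZeroMemClass.coe_zero, mul_zero,
      Matrix.blockDiagonal_apply, Matrix.zero_apply]
    split_ifs
    · obtain ⟨a, _⟩ := i
      obtain ⟨b, _⟩ := j
      fin_cases a <;> fin_cases b <;> rfl
    · rfl
  rw [Matrix.det_mul, Matrix.det_conjTranspose, ← starRingEnd_apply,
    ← Complex.normSq_eq_conj_mul_self, Complex.ofReal_re]
  obtain ⟨u, v, h⟩ := exists_three_mul_det hZ
  have hN : 9 * Complex.normSq Z.det = ((u ^ 2 - u * v + 2 * v ^ 2 : ℤ) : ℝ) := by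
    rw [← normSq_add_mul_period, ← h, Complex.normSq_mul]
    norm_num [Complex.normSq_ofNat]
  have hpos : (0 : ℝ) < ((u ^ 2 - u * v + 2 * v ^ 2 : ℤ) : ℝ) := by
    rw [← hN]
    have := Complex.normSq_pos.2 hdet
    positivity
  have h1 : (1 : ℝ) ≤ ((u ^ 2 - u * v + 2 * v ^ 2 : ℤ) : ℝ) := by
    exact_mod_cast Int.cast_pos.1 hpos
  linarith

/-! ### Generators of the code -/

/-- Polynomials whose values at `ζ₇` form a `ℤ`-basis of `ℤ[ζ₇]`; the first three values form a
basis of the real subring `ℤ[ζ₇ + ζ₇⁻¹]`. -/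
noncomputable def basisPoly : Fin 6 → ℤ[X] := ![1, X + X ^ 6, X ^ 2 + X ^ 5, X, X ^ 2, X ^ 3]

theorem zL_sum : 1 + zL + zL ^ 2 + zL ^ 3 + zL ^ 4 + zL ^ 5 + zL ^ 6 = 0 := by
  apply Subtype.ext
  push_cast
  rw [coe_zL]
  exact zeta7_sum

theorem exists_aeval_eq_sum (p : ℤ[X]) :
    ∃ n : Fin 6 → ℤ, aeval zL p = ∑ b, n b • aeval zL (basisPoly b) := by
  induction p using Polynomial.induction_on' with
  | add p q hp hq =>
    obtain ⟨n, hn⟩ := hp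
    obtain ⟨m, hm⟩ := hq
    exact ⟨n + m, by simp only [map_add, hn, hm, Pi.add_apply, add_smul, Finset.sum_add_distrib]⟩
  | monomial k a =>
    suffices H : ∃ n : Fin 6 → ℤ, zL ^ k = ∑ b, n b • aeval zL (basisPoly b) by
      obtain ⟨n, hn⟩ := H
      refine ⟨a • n, ?_⟩
      simp only [aeval_monomial, hn, Pi.smul_apply, smul_eq_mul, mul_smul, ← Finset.smul_sum]
      rw [eq_intCast, zsmul_eq_mul]
    have hk : k % 7 < 7 := Nat.mod_lt _ (by norm_num)
    rw [pow_eq_pow_mod k zL_pow]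
    simp only [Fin.sum_univ_six, basisPoly, zsmul_eq_mul]
    generalize k % 7 = r at hk
    interval_cases r
    · exact ⟨![1, 0, 0, 0, 0, 0], by simp⟩
    · exact ⟨![0, 0, 0, 1, 0, 0], by simp⟩
    · exact ⟨![0, 0, 0, 0, 1, 0], by simp⟩
    · exact ⟨![0, 0, 0, 0, 0, 1], by simp⟩
    -- Only ζ₇⁴ needs the relation 1 + ζ₇ + ⋯ + ζ₇⁶ = 0.
    · exact ⟨![-1, -1, -1, 0, 0, -1], by simp; linear_combination zL_sum⟩
    · exact ⟨![0, 0, 1, 0, -1, 0], by simp⟩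
    · exact ⟨![0, 1, 0, -1, 0, 0], by simp⟩

/-- The conjugate `τᵏ` of the `b`-th basis element. -/
noncomputable def basisConj (k : Fin 3) (b : Fin 6) : ℂ := aeval (zeta7 ^ 2 ^ (k : ℕ)) (basisPoly b)

theorem star_zeta7 : star zeta7 = zeta7 ^ 6 := by
  have h : star zeta7 * zeta7 = 1 := by
    rw [← starRingEnd_apply, ← Complex.normSq_eq_conj_mul_self, Complex.normSq_eq_norm_sq,
      zeta7_primitive.norm'_eq_one (by norm_num)]
    simp
  linear_combination zeta7 ^ 6 * h - star zeta7 * zeta7_pow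

/-- Conjugation sends a seventh root of unity x to x⁶, so 1, x + x⁶ and x² + x⁵ are real. -/
theorem star_basisConj (k : Fin 3) {b : Fin 6} (hb : (b : ℕ) < 3) :
    star (basisConj k b) = basisConj k b := by
  have h : ∀ m : ℕ, (zeta7 ^ m) ^ 7 = 1 := fun m => by rw [pow_right_comm, zeta7_pow, one_pow]
  have hs : star (zeta7 ^ 2 ^ (k : ℕ)) = (zeta7 ^ 2 ^ (k : ℕ)) ^ 6 := by
    rw [star_pow, star_zeta7, pow_right_comm]
  have hx := h (2 ^ (k : ℕ))
  unfold basisConj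
  generalize zeta7 ^ 2 ^ (k : ℕ) = x at hs hx
  fin_cases b
  · simp [basisPoly]
  · simp only [basisPoly, Fin.mk_one, Matrix.cons_val_one, Matrix.cons_val_zero, map_add, map_pow,
      aeval_X, star_add, star_pow, hs]
    linear_combination (x ^ 29 + x ^ 22 + x ^ 15 + x ^ 8 + x) * hx
  · simp only [basisPoly, Fin.reduceFinMk, Matrix.cons_val, map_add, map_pow,
      aeval_X, star_add, star_pow, hs]
    linear_combination (x ^ 23 + x ^ 16 + x ^ 9 + x ^ 2 + x ^ 5) * hx
  all_goals simp at hb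

/-- A real polynomial vanishing at ζ₇, ζ₇², ζ₇⁴ also vanishes at their complex conjugates, hence at
six points; in degree at most 5 it is zero. -/
theorem eq_zero_of_sum_basisConj (r : Fin 6 → ℝ)
    (h : ∀ k, ∑ b, (r b : ℂ) * basisConj k b = 0) : r = 0 := by
  have hsum : ∀ m : ℕ, m.Coprime 7 → 1 + zeta7 ^ m + (zeta7 ^ m) ^ 2 + (zeta7 ^ m) ^ 3
      + (zeta7 ^ m) ^ 4 + (zeta7 ^ m) ^ 5 + (zeta7 ^ m) ^ 6 = 0 := by
    intro m hm
    have h := (zeta7_primitive.pow_of_coprime m hm).geom_sum_eq_zero (by norm_num)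
    simpa [Finset.sum_range_succ] using h
  -- The coefficients arise from ∑ r_b `basisPoly b` by substituting X⁶ = -(1 + X + ⋯ + X⁵).
  let q : ℂ[X] := ∑ j : Fin 6,
    C ((![r 0 - r 1, r 3, r 2 + r 4 - r 1, r 5 - r 1, -r 1, r 2 - r 1] j : ℝ) : ℂ) * X ^ (j : ℕ)
  have hq : ∀ x, q.eval x = (r 0 - r 1) + r 3 * x + (r 2 + r 4 - r 1) * x ^ 2
      + (r 5 - r 1) * x ^ 3 + (-r 1) * x ^ 4 + (r 2 - r 1) * x ^ 5 := by
    intro x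
    simp [q, Fin.sum_univ_six]
  have hroot : ∀ k : Fin 3, q.eval (zeta7 ^ 2 ^ (k : ℕ)) = 0 := by
    intro k
    have hc : (2 ^ (k : ℕ)).Coprime 7 := Nat.Coprime.pow_left _ (by norm_num)
    have h1 := h k
    have h2 := hsum _ hc
    simp only [Fin.sum_univ_six, basisConj, basisPoly, Matrix.cons_val, map_add, map_pow, map_one,
      aeval_X] at h1
    rw [hq]
    linear_combination h1 - r 1 * h2
  have hstar : ∀ x, q.eval x = 0 → q.eval (star x) = 0 := by
    intro x hx
    rw [hq] at hx ⊢
    have := congrArg star hx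
    simpa [star_add, star_mul', star_sub] using this
  have hroots : ∀ m ∈ ({1, 2, 3, 4, 5, 6} : Finset ℕ), q.eval (zeta7 ^ m) = 0 := by
    have h1 : q.eval (zeta7 ^ 1) = 0 := hroot 0
    have h2 : q.eval (zeta7 ^ 2) = 0 := hroot 1
    have h4 : q.eval (zeta7 ^ 4) = 0 := hroot 2
    have h6 := hstar _ h1
    have h5 := hstar _ h2
    have h3 := hstar _ h4
    rw [star_pow, star_zeta7, ← pow_mul, pow_eq_pow_mod _ zeta7_pow] at h3 h5 h6
    intro m hm
    fin_cases hm <;> assumption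
  have hq0 : q = 0 := by
    refine Polynomial.eq_zero_of_natDegree_lt_card_of_eval_eq_zero' q
      (({1, 2, 3, 4, 5, 6} : Finset ℕ).image (zeta7 ^ ·)) ?_ ?_
    · simpa using hroots
    · rw [Finset.card_image_of_injOn]
      · refine lt_of_le_of_lt (Polynomial.natDegree_sum_le_of_forall_le (n := 5) _ _ ?_) (by decide)
        intro j _
        exact (natDegree_C_mul_X_pow_le _ _).trans (by omega)
      · intro a ha b hb hab
        refine zeta7_primitive.pow_inj ?_ ?_ hab
        · simp at ha; omega
        · simp at hb; omega
  have hcoeff : ∀ j : Fin 6,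
      ![r 0 - r 1, r 3, r 2 + r 4 - r 1, r 5 - r 1, -r 1, r 2 - r 1] j = 0 := by
    intro j
    have := congrArg (fun p => p.coeff (j : ℕ)) hq0
    simp only [q, finsetSum_coeff, coeff_C_mul, coeff_X_pow, coeff_zero, Fin.val_inj,
      mul_ite, mul_one, mul_zero, Finset.sum_ite_eq, Finset.mem_univ, if_true] at this
    exact_mod_cast this
  have h0 := hcoeff 0
  have h1 := hcoeff 1
  have h2 := hcoeff 2
  have h3 := hcoeff 3
  have h4 := hcoeff 4
  have h5 := hcoeff 5
  simp only [Matrix.cons_val] at h0 h1 h2 h3 h4 h5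
  funext b
  fin_cases b <;> simp <;> linarith

/-- The coefficients of the units in the two components of `L²`. -/
noncomputable def unitPair : Fin 4 → FieldL × FieldL := ![(1, 0), (iL, 0), (0, 1), (0, iL)]

/-- The generators of the code, indexed by a unit and an element of the basis of `ℤ[ζ₇]`. -/
noncomputable def genMat (x : Fin 4 × Fin 6) : Matrix (Fin 2 × Fin 3) (Fin 2 × Fin 3) ℂ :=
  alphaTau ((unitPair x.1).1 * aeval zL (basisPoly x.2))
    ((unitPair x.1).2 * aeval zL (basisPoly x.2))

theorem genMat_eq (x : Fin 4 × Fin 6) :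
    genMat x = Matrix.blockDiagonal fun k => basisConj k x.2 • unitMat x.1 := by
  obtain ⟨t, b⟩ := x
  rw [genMat, alphaTau]
  congr 1
  funext k
  have h := coe_tau_pow_aeval k (basisPoly b)
  have hi := tau_pow_iL k
  rw [← basisConj] at h
  generalize tau ^ (k : ℕ) = f at h hi
  ext i j
  fin_cases t <;> fin_cases i <;> fin_cases j <;>
    simp [unitPair, unitMat, block, sigma_aeval_int, sigma_spec.1, hi, h, coe_iL] <;>
    ring

/-- The map `α_τ ∘ X` on pairs, which is additive. -/
noncomputable def alphaTauHom : FieldL × FieldL →+ Matrix (Fin 2 × Fin 3) (Fin 2 × Fin 3) ℂ :=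
  AddMonoidHom.mk' (fun x => alphaTau x.1 x.2) (by
    intro x y
    rw [alphaTau, alphaTau, alphaTau, ← Matrix.blockDiagonal_add]
    congr 1
    funext k
    ext i j
    fin_cases i <;> fin_cases j <;> simp [block] <;> ring)

theorem sum_smul_genMat (g : Fin 4 × Fin 6 → ℤ) :
    ∑ x, g x • genMat x
      = alphaTau (∑ x, g x • ((unitPair x.1).1 * aeval zL (basisPoly x.2)))
          (∑ x, g x • ((unitPair x.1).2 * aeval zL (basisPoly x.2))) := by
  have h := map_sum alphaTauHom (fun x : Fin 4 × Fin 6 =>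
    g x • ((unitPair x.1).1 * aeval zL (basisPoly x.2),
      (unitPair x.1).2 * aeval zL (basisPoly x.2))) Finset.univ
  simp only [map_zsmul] at h
  refine h.symm.trans ?_
  change alphaTau _ _ = _
  simp only [Prod.fst_sum, Prod.snd_sum, Prod.smul_fst, Prod.smul_snd]

theorem code_eq : code = {Z | ∃ g : Fin 4 × Fin 6 → ℤ, Z = ∑ x, g x • genMat x} := by
  ext Z
  constructor
  · rintro ⟨c, hc, d, hd, rfl⟩
    obtain ⟨p, q, rfl⟩ := exists_aeval_intRing hc
    obtain ⟨r, s, rfl⟩ := exists_aeval_intRing hd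
    obtain ⟨n0, h0⟩ := exists_aeval_eq_sum p
    obtain ⟨n1, h1⟩ := exists_aeval_eq_sum q
    obtain ⟨n2, h2⟩ := exists_aeval_eq_sum r
    obtain ⟨n3, h3⟩ := exists_aeval_eq_sum s
    refine ⟨fun x => ![n0, n1, n2, n3] x.1 x.2, ?_⟩
    rw [sum_smul_genMat]
    simp only [Fintype.sum_prod_type, Fin.sum_univ_four, unitPair, h0, h1, h2, h3, Finset.mul_sum,
      mul_smul_comm, Matrix.cons_val, zero_mul, one_mul, smul_zero, Finset.sum_const_zero, add_zero,
      zero_add]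
  · rintro ⟨g, rfl⟩
    rw [sum_smul_genMat]
    have hu : ∀ t, (unitPair t).1 ∈ intRing ∧ (unitPair t).2 ∈ intRing := by
      intro t
      fin_cases t <;> simp [unitPair, iL_mem_intRing, zero_mem, one_mem]
    exact ⟨_, sum_mem fun x _ => zsmul_mem (mul_mem (hu x.1).1 (aeval_mem_intRing _)) _,
      _, sum_mem fun x _ => zsmul_mem (mul_mem (hu x.1).2 (aeval_mem_intRing _)) _, rfl⟩

theorem eq_zero_of_sum_unitMat (s : Fin 4 → ℂ) (h : ∑ t, s t • unitMat t = 0) : s = 0 := by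
  have h11 : (Real.sqrt 11 : ℂ) ≠ 0 := fun h0 => by
    have := sqrt_eleven_mul_self
    rw [h0] at this
    norm_num at this
  have e : ∀ i j, (∑ t, s t • unitMat t) i j = 0 := fun i j => by rw [h]; rfl
  have e00 := e 0 0
  have e01 := e 0 1
  have e10 := e 1 0
  have e11 := e 1 1
  simp [Fin.sum_univ_four, unitMat] at e00 e01 e10 e11
  have hI := Complex.I_ne_zero
  have h0 : s 0 = 0 := by linear_combination (e00 + e11) / 2
  have h1 : s 1 * Complex.I = 0 := by linear_combination (e00 - e11) / 2
  have h2 : s 2 * (Real.sqrt 11 : ℂ) = 0 := by linear_combination (e10 - e01) / 2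
  have h3 : s 3 * ((Real.sqrt 11 : ℂ) * Complex.I) = 0 := by linear_combination (e10 + e01) / 2
  funext t
  fin_cases t
  · simpa using h0
  · simpa [hI] using h1
  · simpa [h11] using h2
  · simpa [hI, h11] using h3

/-- Within each block the four units are independent over ℂ, which leaves one real relation per
unit, valid in all three conjugates. -/
theorem linearIndependent_genMat : LinearIndependent ℝ genMat := by
  rw [Fintype.linearIndependent_iff]
  intro g hg
  have key : ∀ t k, ∑ b, (g (t, b) : ℂ) * basisConj k b = 0 := by
    intro t k
    refine congrFun (eq_zero_of_sum_unitMat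
      (fun t => ∑ b, (g (t, b) : ℂ) * basisConj k b) ?_) t
    ext i j
    have h := congrFun (congrFun hg (i, k)) (j, k)
    simp only [genMat_eq, Matrix.sum_apply, Matrix.smul_apply, Matrix.blockDiagonal_apply, if_true,
      Fintype.sum_prod_type, Matrix.zero_apply] at h
    simp only [Matrix.sum_apply, Matrix.smul_apply, Matrix.zero_apply]
    rw [← h]
    refine Finset.sum_congr rfl fun t _ => ?_
    simp only [smul_eq_mul, Complex.real_smul, Finset.sum_mul, mul_assoc]
  rintro ⟨t, b⟩
  exact congrFun (eq_zero_of_sum_basisConj (fun b => g (t, b)) (key t)) b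

/-! ### Orthogonality -/

/-- The units are the identity and three pairwise anticommuting anti-Hermitian matrices. -/
theorem unitMat_orthogonal {s t : Fin 4} (h : s ≠ t) :
    (unitMat s).conjTranspose * unitMat t + (unitMat t).conjTranspose * unitMat s = 0 ∧
    unitMat s * (unitMat t).conjTranspose + unitMat t * (unitMat s).conjTranspose = 0 := by
  constructor <;> ext i j <;>
    simp only [Matrix.add_apply, Matrix.mul_apply, Fin.sum_univ_two, Matrix.conjTranspose_apply,
      Matrix.zero_apply] <;>
    fin_cases s <;> fin_cases t <;>
    first
    | exact absurd rfl h
    | fin_cases i <;> fin_cases j <;> simp [unitMat, mul_comm, mul_left_comm]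

/-- The scalars must be real: only then do both terms carry the same factor after conjugate
transposition. -/
theorem genMat_orthogonal {x y : Fin 4 × Fin 6} (hx : (x.2 : ℕ) < 3) (hy : (y.2 : ℕ) < 3)
    (h : x.1 ≠ y.1) :
    (genMat x).conjTranspose * genMat y + (genMat y).conjTranspose * genMat x = 0 ∧
    genMat x * (genMat y).conjTranspose + genMat y * (genMat x).conjTranspose = 0 := by
  obtain ⟨h1, h2⟩ := unitMat_orthogonal h
  simp only [genMat_eq, Matrix.blockDiagonal_conjTranspose, ← Matrix.blockDiagonal_mul,
    ← Matrix.blockDiagonal_add, Matrix.conjTranspose_smul, star_basisConj _ hx,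
    star_basisConj _ hy]
  constructor <;> rw [← Matrix.blockDiagonal_zero] <;> congr 1 <;> funext k
  · simp only [Pi.add_apply, Matrix.smul_mul, Matrix.mul_smul, Pi.zero_apply]
    rw [smul_comm, ← smul_add, ← smul_add, h1, smul_zero, smul_zero]
  · simp only [Pi.add_apply, Matrix.smul_mul, Matrix.mul_smul, Pi.zero_apply]
    rw [smul_comm, ← smul_add, ← smul_add, h2, smul_zero, smul_zero]

/-- The generators, enumerated by `Fin 24`. -/
noncomputable def gen (l : Fin 24) : Matrix (Fin 2 × Fin 3) (Fin 2 × Fin 3) ℂ :=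
  genMat ((finProdFinEquiv (m := 4) (n := 6)).symm l)

theorem gen_isGenerating : IsGenerating code gen := by
  refine ⟨linearIndependent_genMat.comp _ (finProdFinEquiv (m := 4) (n := 6)).symm.injective, ?_⟩
  rw [code_eq]
  ext Z
  constructor
  · rintro ⟨g, rfl⟩
    exact ⟨fun l => g ((finProdFinEquiv (m := 4) (n := 6)).symm l),
      (Equiv.sum_comp (finProdFinEquiv (m := 4) (n := 6)).symm fun x => g x • genMat x).symm⟩
  · rintro ⟨g, rfl⟩
    refine ⟨fun x => g (finProdFinEquiv x), ?_⟩
    rw [← Equiv.sum_comp (finProdFinEquiv (m := 4) (n := 6)).symm]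
    exact Finset.sum_congr rfl fun l _ => by
      simp only [Equiv.apply_symm_apply, gen]

/-- The `t`-th group: the `t`-th unit times the basis of the real subring. -/
def group (t : Fin 4) : Finset (Fin 24) :=
  {l | ((finProdFinEquiv (m := 4) (n := 6)).symm l).1 = t ∧
    (((finProdFinEquiv (m := 4) (n := 6)).symm l).2 : ℕ) < 3}

/-- The remaining indices, on which the decoder is conditioned. -/
def condGroup : Finset (Fin 24) :=
  {l | 3 ≤ (((finProdFinEquiv (m := 4) (n := 6)).symm l).2 : ℕ)}

theorem gen_orthogonal {s t : Fin 4} (hst : s ≠ t) {l k : Fin 24} (hl : l ∈ group s)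
    (hk : k ∈ group t) :
    (gen l).conjTranspose * gen k + (gen k).conjTranspose * gen l = 0 ∧
    gen l * (gen k).conjTranspose + gen k * (gen l).conjTranspose = 0 := by
  obtain ⟨hs, hl'⟩ := (Finset.mem_filter.1 hl).2
  obtain ⟨ht, hk'⟩ := (Finset.mem_filter.1 hk).2
  exact genMat_orthogonal hl' hk' (by rwa [hs, ht])

theorem gen_isCondGroupDecodable : IsCondGroupDecodable gen group condGroup where
  nonempty := by decide
  disjoint := by decide
  disjoint_cond := by decide
  cover := by decide
  orthogonal s t hst l hl k hk := by
    rw [(gen_orthogonal hst hl hk).1]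
    simp [frob]

theorem condDegree_group : condDegree group condGroup = 15 := by decide

theorem gen_decodableInOrder : DecodableInOrder gen 15 :=
  condDegree_group ▸ decodableInOrder_of_orthogonal gen_isCondGroupDecodable
    fun _ _ hst _ hl _ hk => (gen_orthogonal hst hl hk).2

end RelayCode

theorem proposition1 :
    -- the quaternion algebras `(-11, -1)` and `(-1, -11)` over `ℚ(ζ₇)` are division algebras
    RelayCode.IsDivision (QuaternionAlgebra RelayCode.FieldK (-11) 0 (-1)) ∧
    RelayCode.IsDivision (QuaternionAlgebra RelayCode.FieldK (-1) 0 (-11)) ∧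
    -- the matrices `X` with `c, d ∈ ℚ(i, ζ₇)` form a faithful copy of the latter
    (∃ ρ : QuaternionAlgebra RelayCode.FieldK (-1) 0 (-11) →ₐ[RelayCode.FieldK]
        Matrix (Fin 2) (Fin 2) ℂ,
      Function.Injective ρ ∧
      Set.range ρ = {X | ∃ c d : RelayCode.FieldL, X = RelayCode.matX c d}) ∧
    RelayCode.HasRank RelayCode.code 24 ∧
    RelayCode.HasNVD RelayCode.code ∧
    (∀ X ∈ RelayCode.code, X.det ∈ RelayCode.FieldQ7) ∧
    -- conditionally 4-group decodable with decoding complexity of order `|S|^15`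
    (∃ (B : Fin 24 → Matrix (Fin 2 × Fin 3) (Fin 2 × Fin 3) ℂ)
        (Γ : Fin 4 → Finset (Fin 24)) (ΓC : Finset (Fin 24)),
      RelayCode.IsGenerating RelayCode.code B ∧
      RelayCode.IsCondGroupDecodable B Γ ΓC ∧
      RelayCode.condDegree Γ ΓC = 15 ∧
      RelayCode.DecodableInOrder B 15) := by
  exact ⟨RelayCode.isDivision_neg_eleven_neg_one, RelayCode.isDivision_neg_one_neg_eleven,
    RelayCode.exists_quaternion_embedding, ⟨RelayCode.gen, RelayCode.gen_isGenerating⟩,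
    RelayCode.code_hasNVD, fun _ hX => RelayCode.det_mem_FieldQ7 hX,
    RelayCode.gen, RelayCode.group, RelayCode.condGroup, RelayCode.gen_isGenerating,
    RelayCode.gen_isCondGroupDecodable, RelayCode.condDegree_group,
    RelayCode.gen_decodableInOrder⟩
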